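/- **Setting.** Let $r\ge 2$, $1\le m_k\le n_k$ ($k=1,\dots,r$), $n=\prod_k n_k$, $m=\prod_k m_k$, $\mathbb U=\mathbb R^{m_1\times\cdots\times m_r}$, $\mathbb V=\mathbb R^{n_1\times\cdots\times n_r}$. For $\boldsymbol A=(A_1,\dots,A_r)$ with $A_k\in\mathbb R^{n_k\times m_k}$, the Tucker map $\mathsf F_{\boldsymbol A}:\mathbb U\to\mathbb V$ has coordinates $\prod_k (A_k)_{i_kj_k}$. Let $\sigma\ge 0$, $N\ge 1$, and let $X_1,\dots,X_N$ be independent random tensors, each of the form $X_i=\mathsf F_{\boldsymbol A}Z_i+\varepsilon_i$ with $Z_i$ standard Gaussian on $\mathbb U$ and $\varepsilon_i$ Gaussian on $\mathbb V$ with mean $0$ and covariance $\sigma^2\mathbb I$, independent of $Z_i$. Put $B_k=A_kA_k^\top$, $\Sigma=\sigma^2\mathbb I+\mathsf F_{\boldsymbol A}\mathsf F_{\boldsymbol A}^*$, $\mathsf S_N=\frac1N\sum_i X_i\otimes X_i$, $\Phi=\sigma^2\mathbb I+\mathsf S_N-\Sigma$, $\omega=\prod_k\|B_k\|_F$, $\|\boldsymbol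 A\|=\prod_k\|A_k\|$ (spectral norms). For a linear map $\mathsf F$ on $\mathbb V$ let $\|\mathsf F\|_{\rm ml}=\max\langle\mathsf F(u_1\otimes\cdots\otimes u_r),v_1\otimes\cdots\otimes v_r\rangle$ over vectors with $\|u_k\|,\|v_k\|\le1$, and for $n_k\times n_k$ matrices $C_k$ write $\langle C_1,\dots,C_r;\mathsf F\rangle=\sum_{i,j}\prod_k (C_k)_{i_kj_k}\mathsf F_{i_1\ldots i_r,j_1\ldots j_r}$. For $\delta_1,\delta_2,\delta_3\in(0,1)$ let $$\psi=\sigma^2+2\sigma^2\max\{\alpha_1,\sqrt{\alpha_1}\}+2\|\boldsymbol A\|^2\max\{\alpha_2,\sqrt{\alpha_2}\}+4\sigma\|\boldsymbol A\|\max\{\alpha_3,\sqrt{\alpha_3}\},$$ $$\alpha_1=\tfrac{2\log(10r)\sum_k n_k+\log(1/\delta_1)}{0.145N},\quad \alpha_2=\tfrac{2\log(10r)\sum_k m_k+\log(1/\delta_2)}{0.145N},\quad \alpha_3=\tfrac3N\Big(\log(10r)\sum_k(n_k+m_k)+\log\tfrac1{\delta_3}\Big),$$ and let $\boldsymbol E(\psi)=\{\|\Phi\|_{\rm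 ml}\le\psi\}$. **One iteration.** Given positive semidefinite $B_k^{(0)}$ with $\operatorname{rank}B_k^{(0)}\le m_k$ and $\|B_k^{(0)}\|_F=1$, let $\tilde B_k$ be the matrix with $\langle\tilde B_k,C\rangle=\langle B_1^{(0)},\dots,B_{k-1}^{(0)},C,B_{k+1}^{(0)},\dots,B_r^{(0)};\mathsf S_N\rangle$ for all $C$, let $\mathrm{Eig}_{m_k}(\tilde B_k)$ keep the top $m_k$ eigenpairs of $\tilde B_k$ (ties broken arbitrarily), and set $B_k^{(1)}=\mathrm{Eig}_{m_k}(\tilde B_k)/\|\mathrm{Eig}_{m_k}(\tilde B_k)\|_F$. Put $\widehat\omega=\langle B_1^{(1)},\dots,B_r^{(1)};\mathsf S_N\rangle$, $\widehat B_k=\widehat\omega^{1/r}B_k^{(1)}$ and $\widehat{\sigma^2}=\frac1n\operatorname{tr}(\mathsf S_N-\mathsf F_{\widehat{\boldsymbol B}})$. **Assumptions.** (i) Equal scaling: $\|B_1\|_F=\cdots=\|B_r\|_F>0$. (ii) Initialization: $(\psi/\omega)^2<\frac1{32m}\cdot\frac1r(1-\frac1r)^{r-1}$, and $0<\tau<\tau_1$,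 where $\tau_1$ is the right end point of the interval of those $x\in(0,1)$ with $x^2(1-x^2)^{r-1}>32m(\psi/\omega)^2$; the angle $\theta_k^{(0)}$ between $\operatorname{vec}(B_k)$ and $\operatorname{vec}(B_k^{(0)})$ satisfies $\sin\theta_k^{(0)}\le\tau$ for all $k$. **Theorem.** There is an event $G$ with $\mathbb P(G)\ge 1-\frac1{N^2n^2}$ such that on $G\cap\boldsymbol E(\psi)$, for all initial matrices as above, $$|\widehat{\sigma^2}-\sigma^2|\le\frac{\sqrt m\,\omega}{n}\Big[\big(1+2f_1(\tau)+\sqrt2f_2(\tau)\big)^r-1\Big]+t_4,$$ where $$f_1(\tau)=\frac\psi\omega\,\frac{4\sqrt{2m}}{(1-\tau^2)^{(r-1)/2}},\qquad f_2(\tau)=\Big(\frac\psi\omega\Big)^2\frac{16mr}{(1-\tau^2)^{r-1}}+\frac\psi\omega\sqrt m,$$ $$t_4=\frac Dn\max\{\alpha_4,\sqrt{\alpha_4}\},\qquad \alpha_4=\frac{2\|\Sigma\|\log(Nn)}{0.145\,N D},\qquad D=m\|\Sigma\|+\frac{(n-m)\sigma^4}{\|\Sigma\|}.$$ -/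

import Mathlib

open MeasureTheory ProbabilityTheory
open scoped BigOperators Matrix

noncomputable section

namespace TPCA

/-! ### Tensors and linear maps between tensor spaces -/

/-- Multi-indices `(i₁, …, i_r)` of an `n₁ × ⋯ × n_r` tensor. -/
abbrev Idx {r : ℕ} (n : Fin r → ℕ) : Type := (k : Fin r) → Fin (n k)

/-- The tensor space `ℝ^{n₁ × ⋯ × n_r}` with its Frobenius inner product. -/
abbrev Tensor {r : ℕ} (n : Fin r → ℕ) : Type := EuclideanSpace ℝ (Idx n)

/-- Linear maps `ℝ^{m₁ × ⋯ × m_r} → ℝ^{n₁ × ⋯ × n_r}`, given by their coordinates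
`F_{i₁…i_r, j₁…j_r}`; the action on tensors is `Matrix.toEuclideanLin`. -/
abbrev Op {r : ℕ} (m n : Fin r → ℕ) : Type := Matrix (Idx n) (Idx m) ℝ

/-- The Tucker map `T ↦ (A₁, …, A_r) · T`. -/
def tucker {r : ℕ} {n m : Fin r → ℕ} (A : (k : Fin r) → Matrix (Fin (n k)) (Fin (m k)) ℝ) :
    Op m n :=
  Matrix.of fun i j => ∏ k, A k (i k) (j k)

/-- The rank-one tensor `v₁ ⊗ ⋯ ⊗ v_r`. -/
def rankOne {r : ℕ} {n : Fin r → ℕ} (v : (k : Fin r) → EuclideanSpace ℝ (Fin (n k))) :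
    Tensor n :=
  WithLp.toLp 2 fun i => ∏ k, v k (i k)

/-- The multilinear spectral norm: the maximum of `⟨F(u₁ ⊗ ⋯ ⊗ u_r), v₁ ⊗ ⋯ ⊗ v_r⟩` over
vectors `u_k`, `v_k` of Euclidean norm at most one. -/
def mlNorm {r : ℕ} {n m : Fin r → ℕ} (F : Op m n) : ℝ :=
  sSup {x : ℝ | ∃ (u : (k : Fin r) → EuclideanSpace ℝ (Fin (m k)))
      (v : (k : Fin r) → EuclideanSpace ℝ (Fin (n k))),
      (∀ k, ‖u k‖ ≤ 1) ∧ (∀ k, ‖v k‖ ≤ 1) ∧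
        x = inner ℝ (Matrix.toEuclideanLin F (rankOne u)) (rankOne v)}

/-- The spectral norm of a (possibly rectangular) matrix. -/
def opNorm {α β : Type*} [Fintype α] [Fintype β] [DecidableEq β] (M : Matrix α β ℝ) : ℝ :=
  ‖LinearMap.toContinuousLinearMap (Matrix.toEuclideanLin M)‖

/-- Vectorization of a matrix, with entries indexed by pairs. -/
def vec {p q : ℕ} (M : Matrix (Fin p) (Fin q) ℝ) : EuclideanSpace ℝ (Fin p × Fin q) :=
  WithLp.toLp 2 fun x => M x.1 x.2

/-- The Frobenius norm. -/
def frob {p q : ℕ} (M : Matrix (Fin p) (Fin q) ℝ) : ℝ := ‖vec M‖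

/-- The flattening of a linear map that pairs the corresponding modes. -/
def pair {r : ℕ} {n m : Fin r → ℕ} (F : Op m n) :
    ((k : Fin r) → Fin (n k) × Fin (m k)) → ℝ :=
  fun p => F (fun k => (p k).1) (fun k => (p k).2)

/-! ### The probabilistic model -/

/-- `X` is Gaussian on the tensor space with mean `μ` and covariance operator `S`: every
`⟨X, T⟩` is normal with mean `⟨μ, T⟩` and variance `⟨S T, T⟩`. -/
def IsGaussianTensor {Ω : Type*} [MeasurableSpace Ω] (P : Measure Ω) {r : ℕ} {n : Fin r → ℕ}
    (X : Ω → Tensor n) (μ : Tensor n) (S : Op n n) : Prop :=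
  AEMeasurable X P ∧ ∀ T : Tensor n,
    P.map (fun ω => (inner ℝ (X ω) T : ℝ)) =
      gaussianReal (inner ℝ μ T) (Real.toNNReal (inner ℝ (Matrix.toEuclideanLin S T) T))

/-- `X = μ + A · Z + ε` with `μ = A · ν` for some `ν`, `Z` standard Gaussian, `ε` Gaussian with
mean zero and covariance `σ² I`, and `Z`, `ε` independent. -/
def IsTPCA {Ω : Type*} [MeasurableSpace Ω] (P : Measure Ω) {r : ℕ} {n m : Fin r → ℕ}
    (X : Ω → Tensor n) (μ : Tensor n)
    (A : (k : Fin r) → Matrix (Fin (n k)) (Fin (m k)) ℝ) (σ : ℝ) : Prop :=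
  (∃ ν : Tensor m, μ = Matrix.toEuclideanLin (tucker A) ν) ∧
    ∃ (Z : Ω → Tensor m) (ε : Ω → Tensor n),
      IsGaussianTensor P Z 0 (1 : Op m m) ∧
      IsGaussianTensor P ε 0 (σ ^ 2 • (1 : Op n n)) ∧
      IndepFun Z ε P ∧
      ∀ᵐ ω ∂P, X ω = μ + Matrix.toEuclideanLin (tucker A) (Z ω) + ε ω

/-- `B_k = A_k A_kᵀ`. -/
def gram {r : ℕ} {n m : Fin r → ℕ} (A : (k : Fin r) → Matrix (Fin (n k)) (Fin (m k)) ℝ)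
    (k : Fin r) : Matrix (Fin (n k)) (Fin (n k)) ℝ :=
  A k * (A k)ᵀ

/-- The covariance operator `Σ = σ² I + F_A F_A^*`. -/
def cov {r : ℕ} {n m : Fin r → ℕ} (A : (k : Fin r) → Matrix (Fin (n k)) (Fin (m k)) ℝ)
    (σ : ℝ) : Op n n :=
  σ ^ 2 • (1 : Op n n) + tucker A * (tucker A)ᵀ

/-- The sample covariance `S_N = N⁻¹ ∑ X_i ⊗ X_i`. -/
def sampleCov {r : ℕ} {n : Fin r → ℕ} {N : ℕ} (x : Fin N → Tensor n) : Op n n :=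
  Matrix.of fun a b => (1 / (N : ℝ)) * ∑ i, x i a * x i b

/-- `Φ = σ² I + S_N - Σ`. -/
def noise {r : ℕ} {n m : Fin r → ℕ} (A : (k : Fin r) → Matrix (Fin (n k)) (Fin (m k)) ℝ)
    (σ : ℝ) {N : ℕ} (x : Fin N → Tensor n) : Op n n :=
  σ ^ 2 • (1 : Op n n) + sampleCov x - cov A σ

/-- The signal strength `ω = ∏ ‖B_k‖_F`. -/
def signal {r : ℕ} {n m : Fin r → ℕ} (A : (k : Fin r) → Matrix (Fin (n k)) (Fin (m k)) ℝ) : ℝ :=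
  ∏ k, frob (gram A k)

/-! ### The rank-one power iteration -/

/-- `B̃_k`, the matrix form of `(b₁ᵀ, …, b_{k-1}ᵀ, I, b_{k+1}ᵀ, …, b_rᵀ) · pair(S)`. -/
def powerUpdate {r : ℕ} {n : Fin r → ℕ} (S : Op n n)
    (B : (k : Fin r) → Matrix (Fin (n k)) (Fin (n k)) ℝ) (k : Fin r) :
    Matrix (Fin (n k)) (Fin (n k)) ℝ :=
  Matrix.of fun a b => ∑ p : (l : Fin r) → Fin (n l) × Fin (n l),
    if p k = (a, b) then (∏ l ∈ Finset.univ.erase k, B l (p l).1 (p l).2) * pair S p else 0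

/-- `E` keeps the top `d` eigenpairs of the symmetric matrix `M` (for some spectral
decomposition of `M` with decreasing eigenvalues) and zeroes out the rest. -/
def IsEigTrunc {p : ℕ} (d : ℕ) (M E : Matrix (Fin p) (Fin p) ℝ) : Prop :=
  ∃ (u : Fin p → EuclideanSpace ℝ (Fin p)) (lam : Fin p → ℝ),
    Orthonormal ℝ u ∧ Antitone lam ∧
    M = ∑ j, lam j • Matrix.vecMulVec (fun a => u j a) (fun a => u j a) ∧
    E = ∑ j : Fin p, if (j : ℕ) < d then
      lam j • Matrix.vecMulVec (fun a => u j a) (fun a => u j a) else 0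

/-- One iteration of the algorithm turns the matrices `B` into the matrices `B'`. -/
def IsIteration {r : ℕ} {n : Fin r → ℕ} (m : Fin r → ℕ) (S : Op n n)
    (B B' : (k : Fin r) → Matrix (Fin (n k)) (Fin (n k)) ℝ) : Prop :=
  ∀ k, ∃ E : Matrix (Fin (n k)) (Fin (n k)) ℝ,
    IsEigTrunc (m k) (powerUpdate S B k) E ∧ B' k = (frob E)⁻¹ • E

/-- Admissible initial matrices: positive semidefinite, of rank at most `m_k` and of unit
Frobenius norm. -/
def IsFeasible {r : ℕ} {n : Fin r → ℕ} (m : Fin r → ℕ)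
    (B : (k : Fin r) → Matrix (Fin (n k)) (Fin (n k)) ℝ) : Prop :=
  ∀ k, (B k).PosSemidef ∧ (B k).rank ≤ m k ∧ frob (B k) = 1

/-- `ω̂ = (b̂₁ᵀ, …, b̂_rᵀ) · pair(S)`. -/
def signalHat {r : ℕ} {n : Fin r → ℕ} (S : Op n n)
    (B : (k : Fin r) → Matrix (Fin (n k)) (Fin (n k)) ℝ) : ℝ :=
  ∑ p : (l : Fin r) → Fin (n l) × Fin (n l), (∏ l, B l (p l).1 (p l).2) * pair S p

/-- `B̂_k = ω̂^{1/r} B_k`, computed from the last iterate `B`. -/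
def gramHat {r : ℕ} {n : Fin r → ℕ} (S : Op n n)
    (B : (k : Fin r) → Matrix (Fin (n k)) (Fin (n k)) ℝ) (k : Fin r) :
    Matrix (Fin (n k)) (Fin (n k)) ℝ :=
  signalHat S B ^ (1 / (r : ℝ)) • B k

/-- The residual estimator `n⁻¹ tr(S - F_{B̂})` of `σ²`, computed from the last iterate `B`. -/
def sigmaSqHat {r : ℕ} {n : Fin r → ℕ} (S : Op n n)
    (B : (k : Fin r) → Matrix (Fin (n k)) (Fin (n k)) ℝ) : ℝ :=
  (1 / (∏ k, (n k : ℝ))) * Matrix.trace (S - tucker (gramHat S B))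

/-- The angle between `vec(B_k) / ‖B_k‖_F` and `vec(M)`. -/
def initAngle {r : ℕ} {n m : Fin r → ℕ}
    (A : (k : Fin r) → Matrix (Fin (n k)) (Fin (m k)) ℝ) (k : Fin r)
    (M : Matrix (Fin (n k)) (Fin (n k)) ℝ) : ℝ :=
  InnerProductGeometry.angle ((frob (gram A k))⁻¹ • vec (gram A k)) (vec M)

/-! ### The explicit quantities of the bound -/

/-- `‖A‖ = ∏ ‖A_k‖`. -/
def loadNorm {r : ℕ} {n m : Fin r → ℕ}
    (A : (k : Fin r) → Matrix (Fin (n k)) (Fin (m k)) ℝ) : ℝ :=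
  ∏ k, opNorm (A k)

/-- `max {x, √x}`. -/
def maxSqrt (x : ℝ) : ℝ := max x (Real.sqrt x)

def alpha₁ {r : ℕ} (n : Fin r → ℕ) (N : ℕ) (δ : ℝ) : ℝ :=
  1 / (0.145 * (N : ℝ)) * (2 * Real.log (10 * (r : ℝ)) * ∑ k, (n k : ℝ) + Real.log (1 / δ))

def alpha₂ {r : ℕ} (m : Fin r → ℕ) (N : ℕ) (δ : ℝ) : ℝ :=
  1 / (0.145 * (N : ℝ)) * (2 * Real.log (10 * (r : ℝ)) * ∑ k, (m k : ℝ) + Real.log (1 / δ))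

def alpha₃ {r : ℕ} (n m : Fin r → ℕ) (N : ℕ) (δ : ℝ) : ℝ :=
  3 / (N : ℝ) * (Real.log (10 * (r : ℝ)) * ∑ k, ((n k : ℝ) + (m k : ℝ)) + Real.log (1 / δ))

/-- The noise level `ψ = σ² + t₁ + t₂ + t₃`. -/
def psi {r : ℕ} {n m : Fin r → ℕ} (A : (k : Fin r) → Matrix (Fin (n k)) (Fin (m k)) ℝ)
    (σ : ℝ) (N : ℕ) (δ₁ δ₂ δ₃ : ℝ) : ℝ :=
  σ ^ 2 + 2 * σ ^ 2 * maxSqrt (alpha₁ n N δ₁)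
    + 2 * loadNorm A ^ 2 * maxSqrt (alpha₂ m N δ₂)
    + 4 * σ * loadNorm A * maxSqrt (alpha₃ n m N δ₃)

/-- `g(x) = x²(1 - x²)^{r-1} - 32 m ρ²`, where `M = m` and `ρ = ψ/ω`. -/
def gFun (r : ℕ) (M ρ x : ℝ) : ℝ := x ^ 2 * (1 - x ^ 2) ^ (r - 1) - 32 * M * ρ ^ 2

/-- The right end point `τ₁(ρ)` of the interval in `(0, 1)` on which `g` is positive. -/
def tauOne (r : ℕ) (M ρ : ℝ) : ℝ := sSup {x : ℝ | 0 < x ∧ x < 1 ∧ 0 < gFun r M ρ x}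

/-- `f₁(τ) = ρ · 4√(2m) / (1 - τ²)^{(r-1)/2}`, where `M = m` and `ρ = ψ/ω`. -/
def f₁ (r : ℕ) (M ρ τ : ℝ) : ℝ :=
  ρ * (4 * Real.sqrt (2 * M) / (1 - τ ^ 2) ^ (((r : ℝ) - 1) / 2))

/-- `f₂(τ) = ρ² · 16 m r / (1 - τ²)^{r-1} + ρ √m`, where `M = m` and `ρ = ψ/ω`. -/
def f₂ (r : ℕ) (M ρ τ : ℝ) : ℝ :=
  ρ ^ 2 * (16 * M * (r : ℝ) / (1 - τ ^ 2) ^ (r - 1)) + ρ * Real.sqrt M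

/-- `D = m ‖Σ‖ + (n - m) σ⁴ / ‖Σ‖`. -/
def effDim {r : ℕ} {n m : Fin r → ℕ} (A : (k : Fin r) → Matrix (Fin (n k)) (Fin (m k)) ℝ)
    (σ : ℝ) : ℝ :=
  (∏ k, (m k : ℝ)) * opNorm (cov A σ)
    + ((∏ k, (n k : ℝ)) - ∏ k, (m k : ℝ)) * σ ^ 4 / opNorm (cov A σ)

/-- `α₄ = 2 ‖Σ‖ log(N n) / (0.145 N D)`. -/
def alpha₄ {r : ℕ} {n m : Fin r → ℕ} (A : (k : Fin r) → Matrix (Fin (n k)) (Fin (m k)) ℝ)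
    (σ : ℝ) (N : ℕ) : ℝ :=
  2 * opNorm (cov A σ) * Real.log ((N : ℝ) * ∏ k, (n k : ℝ)) / (0.145 * (N : ℝ) * effDim A σ)

/-- `t₄ = (D / n) max {α₄, √α₄}`. -/
def t₄ {r : ℕ} {n m : Fin r → ℕ} (A : (k : Fin r) → Matrix (Fin (n k)) (Fin (m k)) ℝ)
    (σ : ℝ) (N : ℕ) : ℝ :=
  effDim A σ / (∏ k, (n k : ℝ)) * maxSqrt (alpha₄ A σ N)

end TPCA

end

/-! Write F_B for the Tucker map of the B_k, so that F_A F_A^* = F_B, S_N = F_B + Φ and tr Σ = nσ² +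
tr F_B. Then n times the error of the variance estimator is (tr S_N - tr Σ) - (tr F_B̂ - tr F_B): a
random fluctuation minus an estimation error that is deterministic once ‖Φ‖_ml ≤ ψ.

Estimation error. On the rank-one part F_B the update returns c·B_k, where c is the product of the
inner products in the other modes; the initial angles give c‖B_k‖_F ≥ ωq with q = (1-τ²)^((r-1)/2).
To bound the noise part, expand each B_l^(0) spectrally: Φ is then tested on rank-one tensors only,
at the price of one nuclear norm ≤ √m_l per mode (`abs_signalHat_le`). Weyl's inequality and the
rank bound turn this into a Frobenius error 2√(2m)ψ after truncation (`IsEigTrunc.frob_sub_le`), so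
the new angle has sine at most s = 2√(2m)(ψ/ω)/q (`sqrt_le_inner_iterate`). Consequently ω̂/ω
differs from 1 by at most f₂: the cosines contribute only to second order in s, the noise (ψ/ω)√m.
Each B̂_k - B_k has rank at most 2m_k, so its trace is at most √(2m_k) times its Frobenius norm.
Since the trace of a Tucker map is the product of the traces, telescoping gives the r-th power
(`abs_trace_tucker_gramHat_sub_le`).

Fluctuation. tr S_N is the mean of the ‖X_i‖². In an eigenbasis of Σ the coordinates of X_i are
independent centred Gaussians, so the moment generating function is explicit. Chernoff's bound in
both directions, with ∑λ_j² ≤ D‖Σ‖, gives total tail at most (Nn)⁻² (`measure_norm_sq_deviation_le`,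
`exists_exp_tails_le`). -/

namespace TPCA

/-! ### Symmetric matrices: spectral estimates -/

section Spectral

/-- The quadratic form of a spectral sum `∑ lam_j u_j u_jᵀ`. -/
theorem dotProduct_sum_vecMulVec_mulVec {ι : Type*} [Fintype ι] {κ : Type*} [Fintype κ] (u : κ → ι → ℝ) (lam : κ → ℝ)
    (x : ι → ℝ) :
    x ⬝ᵥ ((∑ j, lam j • Matrix.vecMulVec (u j) (u j)) *ᵥ x) = ∑ j, lam j * (u j ⬝ᵥ x) ^ 2 := by
  rw [Matrix.sum_mulVec, dotProduct_sum]
  refine Finset.sum_congr rfl fun j _ => ?_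
  rw [Matrix.smul_mulVec, Matrix.vecMulVec_mulVec, dotProduct_smul]
  simp [dotProduct_comm x, sq]

theorem matrix_rank_add_le {ι : Type*} [Fintype ι] (M M' : Matrix ι ι ℝ) : (M + M').rank ≤ M.rank + M'.rank := by
  rw [Matrix.rank, Matrix.rank, Matrix.rank, Matrix.mulVecLin_add]
  exact (Submodule.finrank_mono (LinearMap.range_add_le _ _)).trans
    (Submodule.finrank_add_le_finrank_add_finrank _ _)

variable {ι : Type*} [Fintype ι] [DecidableEq ι]

/-- The spectral decomposition of a symmetric matrix as a sum of rank-one matrices. -/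
theorem isHermitian_eq_sum_vecMulVec {M : Matrix ι ι ℝ} (hM : M.IsHermitian) :
    M = ∑ j, hM.eigenvalues j •
      Matrix.vecMulVec (fun a => hM.eigenvectorBasis j a) (fun a => hM.eigenvectorBasis j a) := by
  conv_lhs => rw [hM.spectral_theorem]
  ext a b
  simp [Unitary.conjStarAlgAut_apply, Matrix.mul_apply, Matrix.sum_apply, Matrix.vecMulVec_apply,
    Matrix.diagonal_apply, Matrix.star_apply]
  exact Finset.sum_congr rfl fun j _ => by ring

theorem sum_sq_eq_sum_sq_eigenvalues {M : Matrix ι ι ℝ} (hM : M.IsHermitian) :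
    ∑ a, ∑ b, M a b ^ 2 = ∑ j, hM.eigenvalues j ^ 2 := by
  have h1 : ∑ a, ∑ b, M a b ^ 2 = (M * M).trace := by
    simp only [Matrix.trace, Matrix.diag, Matrix.mul_apply]
    refine Finset.sum_congr rfl fun a _ => Finset.sum_congr rfl fun b _ => ?_
    have := hM.apply a b
    simp at this
    rw [sq, this]
  rw [h1]
  conv_lhs => rw [hM.spectral_theorem]
  rw [← map_mul, Unitary.conjStarAlgAut_apply, Matrix.trace_mul_cycle]
  simp [Matrix.trace, sq]

theorem card_eigenvalues_ne_zero_le {M : Matrix ι ι ℝ} (hM : M.IsHermitian) {d : ℕ}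
    (hd : M.rank ≤ d) : (Finset.univ.filter fun j => hM.eigenvalues j ≠ 0).card ≤ d := by
  rw [hM.rank_eq_card_non_zero_eigs, Fintype.card_subtype] at hd
  exact hd

/-- Cauchy–Schwarz over the nonzero eigenvalues, of which there are at most d. This is the source of
every factor √m_k. -/
theorem sum_abs_eigenvalues_le {M : Matrix ι ι ℝ} (hM : M.IsHermitian) {d : ℕ}
    (hd : M.rank ≤ d) :
    ∑ j, |hM.eigenvalues j| ≤ Real.sqrt d * Real.sqrt (∑ a, ∑ b, M a b ^ 2) := by
  rw [← Real.sqrt_mul (by positivity)]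
  refine Real.le_sqrt_of_sq_le ?_
  rw [sum_sq_eq_sum_sq_eigenvalues hM]
  set s := Finset.univ.filter fun j => hM.eigenvalues j ≠ 0
  have h1 : ∑ j, |hM.eigenvalues j| = ∑ j ∈ s, |hM.eigenvalues j| := by
    rw [Finset.sum_filter_of_ne]
    intro j _ h h0
    simp [h0] at h
  rw [h1]
  calc (∑ j ∈ s, |hM.eigenvalues j|) ^ 2 ≤ s.card * ∑ j ∈ s, |hM.eigenvalues j| ^ 2 :=
        sq_sum_le_card_mul_sum_sq
    _ ≤ d * ∑ j, hM.eigenvalues j ^ 2 := by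
        simp only [sq_abs]
        gcongr
        · exact card_eigenvalues_ne_zero_le hM hd
        · exact Finset.subset_univ _

theorem abs_eigenvalues_le {M : Matrix ι ι ℝ} (hM : M.IsHermitian) {e : ℝ}
    (he : ∀ x : ι → ℝ, |x ⬝ᵥ (M *ᵥ x)| ≤ e * (x ⬝ᵥ x)) (j : ι) : |hM.eigenvalues j| ≤ e := by
  have h1 := he (hM.eigenvectorBasis j).ofLp
  have h2 : (hM.eigenvectorBasis j).ofLp ⬝ᵥ (hM.eigenvectorBasis j).ofLp = 1 := by
    have := (hM.eigenvectorBasis.orthonormal).1 j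
    rw [EuclideanSpace.norm_eq, Real.sqrt_eq_one] at this
    simpa [dotProduct, sq] using this
  rw [hM.mulVec_eigenvectorBasis, dotProduct_smul, h2] at h1
  simpa using h1

theorem sum_sq_le_of_quadratic_bound {M : Matrix ι ι ℝ} (hM : M.IsHermitian) {d : ℕ}
    (hd : M.rank ≤ d) {e : ℝ} (he : ∀ x : ι → ℝ, |x ⬝ᵥ (M *ᵥ x)| ≤ e * (x ⬝ᵥ x)) :
    ∑ a, ∑ b, M a b ^ 2 ≤ d * e ^ 2 := by
  rw [sum_sq_eq_sum_sq_eigenvalues hM]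
  set s := Finset.univ.filter fun j => hM.eigenvalues j ≠ 0
  have h1 : ∑ j, hM.eigenvalues j ^ 2 = ∑ j ∈ s, hM.eigenvalues j ^ 2 := by
    rw [Finset.sum_filter_of_ne]
    intro j _ h h0
    simp [h0] at h
  rw [h1]
  calc ∑ j ∈ s, hM.eigenvalues j ^ 2 ≤ ∑ j ∈ s, e ^ 2 :=
        Finset.sum_le_sum fun j _ => sq_le_sq.2 ((abs_eigenvalues_le hM he j).trans (le_abs_self e))
    _ = s.card * e ^ 2 := by simp
    _ ≤ d * e ^ 2 := by
        gcongr
        exact card_eigenvalues_ne_zero_le hM hd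

theorem rank_sum_le {ι : Type*} [Fintype ι] {κ : Type*} (s : Finset κ) (M : κ → Matrix ι ι ℝ) :
    (∑ j ∈ s, M j).rank ≤ ∑ j ∈ s, (M j).rank := by
  classical
  induction s using Finset.induction_on with
  | empty => simp
  | insert a s ha ih =>
    rw [Finset.sum_insert ha, Finset.sum_insert ha]
    exact (matrix_rank_add_le _ _).trans (by omega)

theorem rank_smul_le (c : ℝ) (M : Matrix ι ι ℝ) : (c • M).rank ≤ M.rank := by
  have : c • M = (c • (1 : Matrix ι ι ℝ)) * M := by simp
  rw [this]
  exact Matrix.rank_mul_le_right _ _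

end Spectral

/-! ### Frobenius norm -/

theorem frob_sq {p q : ℕ} (M : Matrix (Fin p) (Fin q) ℝ) :
    frob M ^ 2 = ∑ a, ∑ b, M a b ^ 2 := by
  rw [frob, EuclideanSpace.norm_sq_eq, Fintype.sum_prod_type]
  simp [vec]

theorem frob_nonneg {p q : ℕ} (M : Matrix (Fin p) (Fin q) ℝ) : 0 ≤ frob M := norm_nonneg _

theorem frob_eq_sqrt {p q : ℕ} (M : Matrix (Fin p) (Fin q) ℝ) :
    frob M = Real.sqrt (∑ a, ∑ b, M a b ^ 2) := by
  rw [← frob_sq, Real.sqrt_sq (frob_nonneg M)]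

theorem vec_sub {p q : ℕ} (M M' : Matrix (Fin p) (Fin q) ℝ) : vec (M - M') = vec M - vec M' := rfl

theorem vec_smul {p q : ℕ} (c : ℝ) (M : Matrix (Fin p) (Fin q) ℝ) : vec (c • M) = c • vec M := rfl

theorem frob_smul {p q : ℕ} (c : ℝ) (M : Matrix (Fin p) (Fin q) ℝ) :
    frob (c • M) = |c| * frob M := by
  rw [frob, vec_smul, norm_smul, Real.norm_eq_abs, frob]

theorem inner_vec {p q : ℕ} (M M' : Matrix (Fin p) (Fin q) ℝ) :
    inner ℝ (vec M) (vec M') = ∑ a, ∑ b, M a b * M' a b := by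
  rw [PiLp.inner_apply, Fintype.sum_prod_type]
  simp [vec, mul_comm]

theorem abs_trace_le {p : ℕ} {M : Matrix (Fin p) (Fin p) ℝ} (hM : M.IsHermitian) {d : ℕ}
    (hd : M.rank ≤ d) : |M.trace| ≤ Real.sqrt d * frob M := by
  rw [hM.trace_eq_sum_eigenvalues, frob_eq_sqrt]
  exact (Finset.abs_sum_le_sum_abs _ _).trans (sum_abs_eigenvalues_le hM hd)

/-! ### Eigenvalue truncation of a perturbed low-rank matrix -/

section Truncation

variable {p d : ℕ} {M E : Matrix (Fin p) (Fin p) ℝ}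

theorem dotProduct_eq_of_orthonormal {u : Fin p → EuclideanSpace ℝ (Fin p)} (hu : Orthonormal ℝ u)
    (i j : Fin p) : (u i).ofLp ⬝ᵥ (u j).ofLp = if i = j then 1 else 0 := by
  have := orthonormal_iff_ite.1 hu i j
  rw [← this, PiLp.inner_apply]
  simp [dotProduct, mul_comm]

theorem sum_dotProduct_sq_le {u : Fin p → EuclideanSpace ℝ (Fin p)} (hu : Orthonormal ℝ u)
    (x : Fin p → ℝ) : ∑ j, ((u j).ofLp ⬝ᵥ x) ^ 2 ≤ x ⬝ᵥ x := by
  have := hu.sum_inner_products_le (x := WithLp.toLp 2 x) (s := Finset.univ)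
  rw [EuclideanSpace.norm_sq_eq] at this
  simpa [PiLp.inner_apply, dotProduct, mul_comm, sq] using this

theorem IsEigTrunc.isHermitian (h : IsEigTrunc d M E) : E.IsHermitian := by
  obtain ⟨u, lam, -, -, -, rfl⟩ := h
  rw [Matrix.IsHermitian, Matrix.conjTranspose_sum]
  refine Finset.sum_congr rfl fun j _ => ?_
  split_ifs
  · ext a b
    simp [Matrix.vecMulVec_apply, mul_comm]
  · simp

theorem IsEigTrunc.rank_le (h : IsEigTrunc d M E) : E.rank ≤ d := by
  obtain ⟨u, lam, -, -, -, rfl⟩ := h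
  refine (rank_sum_le _ _).trans ?_
  have h1 : ∀ j : Fin p, (if (j : ℕ) < d then
      lam j • Matrix.vecMulVec (fun a => u j a) (fun a => u j a) else 0).rank ≤
      if (j : ℕ) < d then 1 else 0 := by
    intro j
    split_ifs
    · exact (rank_smul_le _ _).trans (Matrix.rank_vecMulVec_le _ _)
    · simp
  refine (Finset.sum_le_sum fun j _ => h1 j).trans ?_
  rw [Finset.sum_ite, Finset.sum_const_zero, add_zero, Finset.sum_const, smul_eq_mul, mul_one]
  calc (Finset.univ.filter fun j : Fin p => (j : ℕ) < d).card
      = ((Finset.univ.filter fun j : Fin p => (j : ℕ) < d).map Fin.valEmbedding).card := by simp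
    _ ≤ (Finset.range d).card := by
        refine Finset.card_le_card fun a ha => ?_
        simp at ha ⊢
        omega
    _ = d := by simp

/-- Weyl's inequality: beyond position `d`, the eigenvalues of a perturbation of a matrix of
rank at most `d` are bounded by the size of the perturbation. -/
theorem eigenvalue_le_of_rank_le {u : Fin p → EuclideanSpace ℝ (Fin p)} (hu : Orthonormal ℝ u)
    {lam : Fin p → ℝ} (hlam : Antitone lam)
    (hM : M = ∑ j, lam j • Matrix.vecMulVec (fun a => u j a) (fun a => u j a))
    {Q : Matrix (Fin p) (Fin p) ℝ} (hQ : Q.rank ≤ d) {e : ℝ}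
    (he : ∀ x : Fin p → ℝ, |x ⬝ᵥ ((M - Q) *ᵥ x)| ≤ e * (x ⬝ᵥ x)) (j : Fin p) (hj : d ≤ j) :
    lam j ≤ e := by
  -- The first j + 1 eigenvectors (indices start at 0) span a space of dimension j + 1 > d, so Q
  -- kills a nonzero vector x in it. On that span the form of M is at least lam j times |x|², while
  -- the form of M - Q is at most e|x|².
  let L : ({i : Fin p // i ≤ j} → ℝ) →ₗ[ℝ] (Fin p → ℝ) :=
    Q.mulVecLin ∘ₗ Fintype.linearCombination ℝ (fun i : {i : Fin p // i ≤ j} => (u i).ofLp)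
  have hker : LinearMap.ker L ≠ ⊥ := by
    intro h
    have h1 := L.finrank_range_add_finrank_ker
    rw [h, finrank_bot, add_zero, Module.finrank_fintype_fun_eq_card] at h1
    have h2 : Module.finrank ℝ (LinearMap.range L) ≤ Q.rank :=
      Submodule.finrank_mono (LinearMap.range_comp_le_range _ _)
    have h3 : Fintype.card {i : Fin p // i ≤ j} = j + 1 := by
      rw [Fintype.card_subtype]
      have : (Finset.univ.filter fun i : Fin p => i ≤ j) = Finset.Iic j := by ext; simp
      rw [this, Fin.card_Iic]
    omega
  obtain ⟨c, hc, hc0⟩ := Submodule.exists_mem_ne_zero_of_ne_bot hker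
  set x : Fin p → ℝ := Fintype.linearCombination ℝ
    (fun i : {i : Fin p // i ≤ j} => (u i).ofLp) c with hx
  have hQx : Q *ᵥ x = 0 := hc
  have hx' : x = ∑ i : {i : Fin p // i ≤ j}, c i • (u i).ofLp := by
    rw [hx, Fintype.linearCombination_apply]
  have hux : ∀ i, (u i).ofLp ⬝ᵥ x = if h : i ≤ j then c ⟨i, h⟩ else 0 := by
    intro i
    rw [hx', dotProduct_sum]
    simp only [dotProduct_smul, dotProduct_eq_of_orthonormal hu, smul_eq_mul, mul_ite, mul_one,
      mul_zero]
    split_ifs with h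
    · rw [Finset.sum_eq_single ⟨i, h⟩]
      · simp
      · intro b _ hb
        rw [if_neg]
        rintro rfl
        exact hb rfl
      · simp
    · refine Finset.sum_eq_zero fun b _ => if_neg ?_
      rintro rfl
      exact h b.2
  have hsum : ∀ f : Fin p → ℝ, ∑ i, f i * ((u i).ofLp ⬝ᵥ x) ^ 2
      = ∑ i : {i : Fin p // i ≤ j}, f i * c i ^ 2 := by
    intro f
    have h0 : ∀ i, f i * ((u i).ofLp ⬝ᵥ x) ^ 2 ≠ 0 → i ≤ j := by
      intro i h
      by_contra hij
      rw [hux, dif_neg hij] at h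
      simp at h
    rw [← Finset.sum_filter_of_ne fun i _ => h0 i,
      Finset.sum_subtype (p := fun i => i ≤ j) (Finset.univ.filter fun i => i ≤ j) (by simp)
        fun i => f i * ((u i).ofLp ⬝ᵥ x) ^ 2]
    refine Finset.sum_congr rfl fun i _ => ?_
    rw [hux, dif_pos i.2]
  have hxx : x ⬝ᵥ x = ∑ i, c i ^ 2 := by
    have h0 : x ⬝ᵥ x = (∑ i : {i : Fin p // i ≤ j}, c i • (u i).ofLp) ⬝ᵥ x := by rw [← hx']
    rw [h0, sum_dotProduct]
    refine Finset.sum_congr rfl fun i _ => ?_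
    rw [smul_dotProduct, hux, dif_pos i.2, smul_eq_mul, sq]
  have hpos : 0 < ∑ i, c i ^ 2 := by
    obtain ⟨i, hi⟩ := Function.ne_iff.1 hc0
    exact Finset.sum_pos' (fun i _ => sq_nonneg _) ⟨i, Finset.mem_univ _, sq_pos_of_ne_zero hi⟩
  have h1 := (le_abs_self _).trans (he x)
  rw [Matrix.sub_mulVec, hQx, sub_zero, hM, dotProduct_sum_vecMulVec_mulVec, hsum, hxx] at h1
  have h2 : lam j * ∑ i, c i ^ 2 ≤ ∑ i : {i : Fin p // i ≤ j}, lam i * c i ^ 2 := by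
    rw [Finset.mul_sum]
    exact Finset.sum_le_sum fun i _ => mul_le_mul_of_nonneg_right (hlam i.2) (sq_nonneg _)
  exact le_of_mul_le_mul_right (h2.trans h1) hpos

/-- The eigenvalue truncation of a perturbation of a positive semidefinite matrix of rank at
most `d` is close to that matrix in Frobenius norm. -/
theorem IsEigTrunc.frob_sub_le (h : IsEigTrunc d M E) {Q : Matrix (Fin p) (Fin p) ℝ}
    (hQ : Q.PosSemidef) (hQd : Q.rank ≤ d) {e : ℝ} (he0 : 0 ≤ e)
    (he : ∀ x : Fin p → ℝ, |x ⬝ᵥ ((M - Q) *ᵥ x)| ≤ e * (x ⬝ᵥ x)) :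
    frob (E - Q) ≤ Real.sqrt (2 * d) * (2 * e) := by
  have hrank : (E - Q).rank ≤ 2 * d := by
    have h1 : E - Q = E + (-1 : ℝ) • Q := by simp [sub_eq_add_neg]
    rw [h1]
    have := matrix_rank_add_le E ((-1 : ℝ) • Q)
    have := rank_smul_le (-1) Q
    have := h.rank_le
    omega
  have hherm : (E - Q).IsHermitian := h.isHermitian.sub hQ.1
  obtain ⟨u, lam, hu, hlam, hM, hE⟩ := h
  -- Positivity of Q gives this for every j. With Weyl's upper bound, all discarded eigenvalues lie
  -- in [-e, e], whence a second e for E - M in addition to the one for M - Q.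
  have hlow : ∀ j, -e ≤ lam j := by
    intro j
    have h1 := he (u j).ofLp
    have h2 := hQ.dotProduct_mulVec_nonneg (u j).ofLp
    rw [Matrix.sub_mulVec, dotProduct_sub, hM, dotProduct_sum_vecMulVec_mulVec,
      dotProduct_eq_of_orthonormal hu] at h1
    simp only [dotProduct_eq_of_orthonormal hu] at h1
    simp at h1 h2
    have := neg_le_of_abs_le h1
    linarith
  have hup : ∀ j : Fin p, d ≤ j → lam j ≤ e := eigenvalue_le_of_rank_le hu hlam hM hQd he
  have hdiff : ∀ x : Fin p → ℝ, |x ⬝ᵥ ((E - M) *ᵥ x)| ≤ e * (x ⬝ᵥ x) := by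
    intro x
    have h1 : E - M = ∑ j : Fin p, (if (j : ℕ) < d then 0 else - lam j) •
        Matrix.vecMulVec (fun a => u j a) (fun a => u j a) := by
      rw [hE, hM, ← Finset.sum_sub_distrib]
      refine Finset.sum_congr rfl fun j _ => ?_
      split_ifs <;> simp
    rw [h1, dotProduct_sum_vecMulVec_mulVec]
    refine (Finset.abs_sum_le_sum_abs _ _).trans ?_
    refine le_trans ?_ (mul_le_mul_of_nonneg_left (sum_dotProduct_sq_le hu x) he0)
    rw [Finset.mul_sum]
    refine Finset.sum_le_sum fun j _ => ?_
    rw [abs_mul, abs_of_nonneg (sq_nonneg (_ : ℝ))]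
    refine mul_le_mul_of_nonneg_right ?_ (sq_nonneg _)
    split_ifs with hj
    · simpa using he0
    · rw [abs_neg, abs_le]
      exact ⟨hlow j, hup j (not_lt.1 hj)⟩
  have hq : ∀ x : Fin p → ℝ, |x ⬝ᵥ ((E - Q) *ᵥ x)| ≤ (2 * e) * (x ⬝ᵥ x) := by
    intro x
    have : E - Q = (E - M) + (M - Q) := by abel
    rw [this, Matrix.add_mulVec, dotProduct_add]
    refine (abs_add_le _ _).trans ?_
    linarith [hdiff x, he x]
  rw [frob_eq_sqrt]
  refine (Real.sqrt_le_sqrt (sum_sq_le_of_quadratic_bound hherm hrank hq)).trans ?_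
  rw [Real.sqrt_mul (by positivity), Real.sqrt_sq (by positivity)]
  push_cast
  exact le_rfl

end Truncation

/-! ### Multilinear contractions -/

section Contraction

variable {r : ℕ} {n m : Fin r → ℕ}

theorem prod_update {β : Fin r → Type*} (g : (l : Fin r) → β l → ℝ) (B : (l : Fin r) → β l)
    (k : Fin r) (c : β k) :
    ∏ l, g l (Function.update B k c l) = g k c * ∏ l ∈ Finset.univ.erase k, g l (B l) := by
  rw [← Finset.mul_prod_erase _ _ (Finset.mem_univ k), Function.update_self]
  congr 1
  refine Finset.prod_congr rfl fun l hl => ?_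
  rw [Function.update_of_ne (Finset.ne_of_mem_erase hl)]

theorem signalHat_add (S S' : Op n n) (C : (k : Fin r) → Matrix (Fin (n k)) (Fin (n k)) ℝ) :
    signalHat (S + S') C = signalHat S C + signalHat S' C := by
  simp only [signalHat, pair, Matrix.add_apply, mul_add, Finset.sum_add_distrib]

theorem signalHat_tucker (G C : (k : Fin r) → Matrix (Fin (n k)) (Fin (n k)) ℝ) :
    signalHat (tucker G) C = ∏ k, inner ℝ (vec (C k)) (vec (G k)) := by
  simp only [inner_vec, ← Fintype.sum_prod_type', Finset.prod_univ_sum, Fintype.piFinset_univ]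
  refine Finset.sum_congr rfl fun p _ => ?_
  simp [pair, tucker, Finset.prod_mul_distrib]

theorem trace_tucker (G : (k : Fin r) → Matrix (Fin (n k)) (Fin (n k)) ℝ) :
    (tucker G).trace = ∏ k, (G k).trace := by
  simp only [Matrix.trace, Finset.prod_univ_sum, Fintype.piFinset_univ]
  rfl

theorem tucker_mul_transpose (A : (k : Fin r) → Matrix (Fin (n k)) (Fin (m k)) ℝ) :
    tucker A * (tucker A)ᵀ = tucker (gram A) := by
  ext i j
  simp only [Matrix.mul_apply, tucker, Matrix.of_apply, Matrix.transpose_apply, gram,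
    Finset.prod_univ_sum, Fintype.piFinset_univ, Finset.prod_mul_distrib]

/-- Contracting `B̃_k` with a matrix in the remaining mode. -/
theorem sum_mul_powerUpdate (S : Op n n) (B : (k : Fin r) → Matrix (Fin (n k)) (Fin (n k)) ℝ)
    (k : Fin r) (c : Matrix (Fin (n k)) (Fin (n k)) ℝ) :
    ∑ a, ∑ b, c a b * powerUpdate S B k a b = signalHat S (Function.update B k c) := by
  simp only [powerUpdate, Matrix.of_apply, Finset.mul_sum, mul_ite, mul_zero]
  rw [← Fintype.sum_prod_type' (f := fun a b => ∑ p : (l : Fin r) → Fin (n l) × Fin (n l),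
    if p k = (a, b) then c a b * ((∏ l ∈ Finset.univ.erase k, B l (p l).1 (p l).2) * pair S p)
      else 0), Finset.sum_comm]
  refine Finset.sum_congr rfl fun p _ => ?_
  rw [prod_update (fun l (M : Matrix (Fin (n l)) (Fin (n l)) ℝ) => M (p l).1 (p l).2) B k c]
  rw [Finset.sum_eq_single (p k)]
  · simp [mul_assoc]
  · intro b _ hb
    rw [if_neg (Ne.symm hb)]
  · simp

theorem dotProduct_powerUpdate_mulVec (S : Op n n)
    (B : (k : Fin r) → Matrix (Fin (n k)) (Fin (n k)) ℝ) (k : Fin r) (x : Fin (n k) → ℝ) :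
    x ⬝ᵥ (powerUpdate S B k *ᵥ x) =
      signalHat S (Function.update B k (Matrix.vecMulVec x x)) := by
  rw [← sum_mul_powerUpdate]
  simp only [dotProduct, Matrix.mulVec, Finset.mul_sum, Matrix.vecMulVec_apply]
  refine Finset.sum_congr rfl fun a _ => Finset.sum_congr rfl fun b _ => by ring

theorem powerUpdate_apply (S : Op n n) (B : (k : Fin r) → Matrix (Fin (n k)) (Fin (n k)) ℝ)
    (k : Fin r) (a b : Fin (n k)) :
    powerUpdate S B k a b = signalHat S (Function.update B k (Matrix.single a b 1)) := by
  rw [← sum_mul_powerUpdate]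
  simp [Matrix.single_apply, ite_and]

theorem powerUpdate_add (S S' : Op n n) (B : (k : Fin r) → Matrix (Fin (n k)) (Fin (n k)) ℝ)
    (k : Fin r) : powerUpdate (S + S') B k = powerUpdate S B k + powerUpdate S' B k := by
  ext a b
  simp only [Matrix.add_apply, powerUpdate_apply, signalHat_add]

/-- On a Tucker map every mode except k contracts to a scalar, so the signal part of the update is
exactly a multiple of the factor sought. -/
theorem powerUpdate_tucker (G B : (k : Fin r) → Matrix (Fin (n k)) (Fin (n k)) ℝ) (k : Fin r) :
    powerUpdate (tucker G) B k =
      (∏ l ∈ Finset.univ.erase k, (inner ℝ (vec (B l)) (vec (G l)) : ℝ)) • G k := by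
  ext a b
  rw [powerUpdate_apply, signalHat_tucker,
    prod_update (fun l (M : Matrix (Fin (n l)) (Fin (n l)) ℝ) =>
      (inner ℝ (vec M) (vec (G l)) : ℝ)) B k, inner_vec, Matrix.smul_apply, smul_eq_mul, mul_comm]
  simp [Matrix.single_apply, ite_and]

/-! ### The multilinear spectral norm -/

theorem norm_rankOne (v : (k : Fin r) → EuclideanSpace ℝ (Fin (n k))) :
    ‖rankOne v‖ = ∏ k, ‖v k‖ := by
  rw [← sq_eq_sq₀ (norm_nonneg _) (Finset.prod_nonneg fun _ _ => norm_nonneg _),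
    ← Finset.prod_pow, EuclideanSpace.norm_sq_eq]
  simp only [EuclideanSpace.norm_sq_eq, Finset.prod_univ_sum, Fintype.piFinset_univ]
  refine Finset.sum_congr rfl fun i _ => ?_
  simp [rankOne, Finset.prod_pow, ← Finset.abs_prod]

theorem inner_toEuclideanLin_rankOne_le (F : Op m n)
    {u : (k : Fin r) → EuclideanSpace ℝ (Fin (m k))}
    {v : (k : Fin r) → EuclideanSpace ℝ (Fin (n k))} (hu : ∀ k, ‖u k‖ ≤ 1) (hv : ∀ k, ‖v k‖ ≤ 1) :
    inner ℝ (Matrix.toEuclideanLin F (rankOne u)) (rankOne v) ≤ mlNorm F := by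
  -- A real `sSup` dominates its set only if the set is bounded above; the operator norm supplies
  -- the bound.
  refine le_csSup ⟨‖LinearMap.toContinuousLinearMap (Matrix.toEuclideanLin F)‖, ?_⟩
    ⟨u, v, hu, hv, rfl⟩
  rintro x ⟨u, v, hu, hv, rfl⟩
  have h1 : ‖rankOne u‖ ≤ 1 := by
    rw [norm_rankOne]
    exact Finset.prod_le_one (fun _ _ => norm_nonneg _) fun k _ => hu k
  have h2 : ‖rankOne v‖ ≤ 1 := by
    rw [norm_rankOne]
    exact Finset.prod_le_one (fun _ _ => norm_nonneg _) fun k _ => hv k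
  refine (real_inner_le_norm _ _).trans ?_
  have h3 := (LinearMap.toContinuousLinearMap (Matrix.toEuclideanLin F)).le_opNorm (rankOne u)
  rw [LinearMap.coe_toContinuousLinearMap'] at h3
  calc _ ≤ ‖LinearMap.toContinuousLinearMap (Matrix.toEuclideanLin F)‖ * 1 * 1 :=
        mul_le_mul (h3.trans (by gcongr)) h2 (norm_nonneg _) (by positivity)
    _ = _ := by ring

theorem rankOne_update_neg (v : (k : Fin r) → EuclideanSpace ℝ (Fin (n k))) (k : Fin r) :
    rankOne (Function.update v k (-v k)) = -rankOne v := by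
  ext i
  simp only [rankOne, PiLp.neg_apply]
  rw [prod_update (fun l (w : EuclideanSpace ℝ (Fin (n l))) => w (i l)) v k,
    ← Finset.mul_prod_erase _ _ (Finset.mem_univ k)]
  simp

/-- The supremum has no absolute value. Flipping the sign of one v_k negates the form, which
requires at least one mode. -/
theorem abs_inner_toEuclideanLin_rankOne_le (hr : 0 < r) (F : Op m n)
    {u : (k : Fin r) → EuclideanSpace ℝ (Fin (m k))}
    {v : (k : Fin r) → EuclideanSpace ℝ (Fin (n k))} (hu : ∀ k, ‖u k‖ ≤ 1) (hv : ∀ k, ‖v k‖ ≤ 1) :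
    |inner ℝ (Matrix.toEuclideanLin F (rankOne u)) (rankOne v)| ≤ mlNorm F := by
  refine abs_le'.2 ⟨inner_toEuclideanLin_rankOne_le F hu hv, ?_⟩
  rw [← inner_neg_right, ← rankOne_update_neg v ⟨0, hr⟩]
  refine inner_toEuclideanLin_rankOne_le F hu fun k => ?_
  rcases eq_or_ne k ⟨0, hr⟩ with rfl | hk
  · simpa using hv _
  · rw [Function.update_of_ne hk]
    exact hv k

theorem signalHat_vecMulVec (F : Op n n) (u v : (k : Fin r) → EuclideanSpace ℝ (Fin (n k))) :
    signalHat F (fun k => Matrix.vecMulVec (v k).ofLp (u k).ofLp) =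
      inner ℝ (Matrix.toEuclideanLin F (rankOne u)) (rankOne v) := by
  rw [signalHat, ← (Equiv.arrowProdEquivProdArrow (Fin r) (fun k => Fin (n k))
    (fun k => Fin (n k))).symm.sum_comp, Fintype.sum_prod_type, PiLp.inner_apply]
  refine Finset.sum_congr rfl fun i _ => ?_
  simp only [Matrix.toLpLin_apply, Matrix.mulVec, dotProduct, rankOne, pair,
    Matrix.vecMulVec_apply, Finset.prod_mul_distrib, RCLike.inner_apply, conj_trivial,
    Finset.mul_sum]
  refine Finset.sum_congr rfl fun j _ => ?_
  simp [Equiv.arrowProdEquivProdArrow]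
  ring

/-- Spectral expansion of every C_k makes the contraction a sum over tuples of eigenvectors. Each
term is F tested on rank-one tensors of unit vectors, and the absolute weights sum to the product of
the nuclear norms. -/
theorem abs_signalHat_le (hr : 0 < r) (F : Op n n)
    {C : (k : Fin r) → Matrix (Fin (n k)) (Fin (n k)) ℝ} (hC : ∀ k, (C k).IsHermitian)
    {d : Fin r → ℕ} (hd : ∀ k, (C k).rank ≤ d k) :
    |signalHat F C| ≤ mlNorm F * ∏ k, (Real.sqrt (d k) * frob (C k)) := by
  have hml : 0 ≤ mlNorm F := (abs_nonneg _).trans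
    (abs_inner_toEuclideanLin_rankOne_le hr F (u := 0) (v := 0) (by simp) (by simp))
  have h1 : signalHat F C = ∑ J : (k : Fin r) → Fin (n k), (∏ k, (hC k).eigenvalues (J k)) *
      signalHat F (fun k => Matrix.vecMulVec ((hC k).eigenvectorBasis (J k)).ofLp
        ((hC k).eigenvectorBasis (J k)).ofLp) := by
    simp only [signalHat, Finset.mul_sum]
    rw [Finset.sum_comm]
    refine Finset.sum_congr rfl fun p _ => ?_
    have h2 : ∀ k, C k (p k).1 (p k).2 = ∑ j, (hC k).eigenvalues j *
        Matrix.vecMulVec ((hC k).eigenvectorBasis j).ofLp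
          ((hC k).eigenvectorBasis j).ofLp (p k).1 (p k).2 := by
      intro k
      conv_lhs => rw [isHermitian_eq_sum_vecMulVec (hC k)]
      simp [Matrix.sum_apply]
    simp only [h2, Finset.prod_univ_sum, Fintype.piFinset_univ, Finset.sum_mul,
      Finset.prod_mul_distrib, mul_assoc]
  rw [h1]
  refine (Finset.abs_sum_le_sum_abs _ _).trans ?_
  have h3 : ∀ J : (k : Fin r) → Fin (n k), |(∏ k, (hC k).eigenvalues (J k)) *
      signalHat F (fun k => Matrix.vecMulVec ((hC k).eigenvectorBasis (J k)).ofLp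
        ((hC k).eigenvectorBasis (J k)).ofLp)| ≤ mlNorm F * ∏ k, |(hC k).eigenvalues (J k)| := by
    intro J
    rw [abs_mul, Finset.abs_prod, mul_comm]
    refine mul_le_mul_of_nonneg_right ?_ (Finset.prod_nonneg fun _ _ => abs_nonneg _)
    rw [signalHat_vecMulVec]
    exact abs_inner_toEuclideanLin_rankOne_le hr F (by simp) (by simp)
  refine (Finset.sum_le_sum fun J _ => h3 J).trans ?_
  rw [← Finset.mul_sum]
  refine mul_le_mul_of_nonneg_left ?_ hml
  have h4 : ∑ J : (k : Fin r) → Fin (n k), ∏ k, |(hC k).eigenvalues (J k)| =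
      ∏ k, ∑ j, |(hC k).eigenvalues j| := by
    rw [Finset.prod_univ_sum, Fintype.piFinset_univ]
  rw [h4]
  refine Finset.prod_le_prod (fun k _ => Finset.sum_nonneg fun _ _ => abs_nonneg _) fun k _ => ?_
  rw [frob_eq_sqrt]
  exact sum_abs_eigenvalues_le (hC k) (hd k)

end Contraction

/-! ### One step of the power iteration -/

/-! ### Scalar and inner-product inequalities. -/

section Elementary

/-- A point of the ball of radius κs around κb makes an angle of sine at most s with b. Expanding
the square gives ‖e‖² + κ²(1 - s²) ≤ 2κ⟨e, b⟩, and the left side is at least 2κ√(1 - s²)‖e‖. -/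
theorem sqrt_le_inner_of_norm_sub_le {V : Type*} [NormedAddCommGroup V] [InnerProductSpace ℝ V]
    {e b : V} {κ s : ℝ} (hb : ‖b‖ = 1) (hκ : 0 < κ) (hs0 : 0 ≤ s) (hs : s < 1)
    (h : ‖e - κ • b‖ ≤ κ * s) :
    e ≠ 0 ∧ Real.sqrt (1 - s ^ 2) ≤ inner ℝ (‖e‖⁻¹ • e) b := by
  have he : e ≠ 0 := by
    rintro rfl
    rw [zero_sub, norm_neg, norm_smul, hb, Real.norm_eq_abs, abs_of_pos hκ] at h
    nlinarith
  refine ⟨he, ?_⟩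
  have hpos : 0 < ‖e‖ := norm_pos_iff.2 he
  have h1 : ‖e - κ • b‖ ^ 2 ≤ (κ * s) ^ 2 := pow_le_pow_left₀ (norm_nonneg _) h 2
  rw [norm_sub_sq_real, norm_smul, hb, inner_smul_right, Real.norm_eq_abs, abs_of_pos hκ] at h1
  have hq := Real.sq_sqrt (show 0 ≤ 1 - s ^ 2 by nlinarith)
  set q := Real.sqrt (1 - s ^ 2)
  rw [inner_smul_left, conj_trivial, inv_mul_eq_div, le_div_iff₀ hpos]
  have h2 : κ * (q * ‖e‖) ≤ κ * inner ℝ e b := by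
    nlinarith [sq_nonneg (‖e‖ - κ * q)]
  exact le_of_mul_le_mul_left h2 hκ

theorem norm_sub_le_sqrt_two_mul {V : Type*} [NormedAddCommGroup V] [InnerProductSpace ℝ V]
    {a b : V} {s : ℝ} (ha : ‖a‖ = 1) (hb : ‖b‖ = 1) (hs0 : 0 ≤ s) (hs : s < 1)
    (h : Real.sqrt (1 - s ^ 2) ≤ inner ℝ a b) : ‖a - b‖ ≤ Real.sqrt 2 * s := by
  have h0 : 0 ≤ 1 - s ^ 2 := by nlinarith
  have h1 : 1 - s ^ 2 ≤ Real.sqrt (1 - s ^ 2) :=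
    Real.le_sqrt_of_sq_le (by nlinarith)
  refine abs_le_of_sq_le_sq' ?_ (by positivity) |>.2
  rw [norm_sub_sq_real, ha, hb, mul_pow, Real.sq_sqrt (by norm_num)]
  linarith

theorem one_sub_le_sqrt_pow {r : ℕ} (hr : 2 ≤ r) {y : ℝ} (hy : y ≤ 1) :
    1 - r / 2 * y ≤ Real.sqrt (1 - y) ^ r := by
  have hr' : (2 : ℝ) ≤ r := by exact_mod_cast hr
  have h := one_add_mul_self_le_rpow_one_add (s := -y) (by linarith) (p := (r : ℝ) / 2)
    (by linarith)
  rw [Real.sqrt_eq_rpow, ← Real.rpow_natCast, ← Real.rpow_mul (by linarith)]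
  calc 1 - r / 2 * y = 1 + (r : ℝ) / 2 * -y := by ring
    _ ≤ (1 + -y) ^ ((r : ℝ) / 2) := h
    _ = _ := by ring_nf

/-- The r-th root of t lies between 1 and t. -/
theorem abs_rpow_inv_sub_one_le {r : ℕ} (hr : 1 ≤ r) {t : ℝ} (ht : 0 ≤ t) :
    |t ^ (1 / (r : ℝ)) - 1| ≤ |t - 1| := by
  have hr' : (1 : ℝ) ≤ r := by exact_mod_cast hr
  have hp0 : 0 ≤ 1 / (r : ℝ) := by positivity
  have hp1 : 1 / (r : ℝ) ≤ 1 := by rw [div_le_one (by linarith)]; exact hr'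
  rcases le_total t 1 with h | h
  · have h1 : t ^ (1 / (r : ℝ)) ≤ 1 := Real.rpow_le_one ht h hp0
    have h2 : t ≤ t ^ (1 / (r : ℝ)) := by
      rcases ht.eq_or_lt with rfl | ht'
      · positivity
      · simpa using Real.rpow_le_rpow_of_exponent_ge ht' h hp1
    rw [abs_of_nonpos (by linarith), abs_of_nonpos (by linarith)]
    linarith
  · have h1 : 1 ≤ t ^ (1 / (r : ℝ)) := Real.one_le_rpow h hp0
    have h2 : t ^ (1 / (r : ℝ)) ≤ t := by
      simpa using Real.rpow_le_rpow_of_exponent_le h hp1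
    rw [abs_of_nonneg (by linarith), abs_of_nonneg (by linarith)]
    linarith

theorem abs_prod_sub_prod_le {ι : Type*} (s : Finset ι) {x y Y : ι → ℝ} {η : ℝ} (hη : 0 ≤ η)
    (hy : ∀ i, |y i| ≤ Y i) (hxy : ∀ i, |x i - y i| ≤ Y i * η) :
    |∏ i ∈ s, x i - ∏ i ∈ s, y i| ≤ (∏ i ∈ s, Y i) * ((1 + η) ^ s.card - 1) := by
  classical
  have hY : ∀ i, 0 ≤ Y i := fun i => (abs_nonneg _).trans (hy i)
  induction s using Finset.induction_on with
  | empty => simp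
  | insert a s ha ih =>
    rw [Finset.prod_insert ha, Finset.prod_insert ha, Finset.prod_insert ha,
      Finset.card_insert_of_notMem ha]
    have hyP : |∏ i ∈ s, y i| ≤ ∏ i ∈ s, Y i := by
      rw [Finset.abs_prod]
      exact Finset.prod_le_prod (fun _ _ => abs_nonneg _) fun i _ => hy i
    have hx : |x a| ≤ Y a * (1 + η) := by
      have := abs_add_le (x a - y a) (y a)
      rw [sub_add_cancel] at this
      linarith [hy a, hxy a]
    have h1 : x a * ∏ i ∈ s, x i - y a * ∏ i ∈ s, y i =
      x a * (∏ i ∈ s, x i - ∏ i ∈ s, y i) + (x a - y a) * ∏ i ∈ s, y i := by ring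
    rw [h1]
    refine (abs_add_le _ _).trans ?_
    rw [abs_mul, abs_mul]
    have h2 : |x a| * |∏ i ∈ s, x i - ∏ i ∈ s, y i| ≤
        Y a * (1 + η) * ((∏ i ∈ s, Y i) * ((1 + η) ^ s.card - 1)) :=
      mul_le_mul hx ih (abs_nonneg _) (mul_nonneg (hY a) (by linarith))
    have h3 : |x a - y a| * |∏ i ∈ s, y i| ≤ Y a * η * ∏ i ∈ s, Y i :=
      mul_le_mul (hxy a) hyP (abs_nonneg _) (mul_nonneg (hY a) hη)
    rw [pow_succ]
    linarith

end Elementary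

/-! ### Perturbation of the signal in a single update. -/

section Step

variable {r : ℕ} {n m : Fin r → ℕ}

theorem frob_vecMulVec_self {p : ℕ} (x : Fin p → ℝ) : frob (Matrix.vecMulVec x x) = x ⬝ᵥ x := by
  rw [frob_eq_sqrt]
  have h : ∑ a, ∑ b, Matrix.vecMulVec x x a b ^ 2 = (x ⬝ᵥ x) ^ 2 := by
    simp only [Matrix.vecMulVec_apply, sq, dotProduct, Finset.sum_mul_sum]
    exact Finset.sum_congr rfl fun a _ => Finset.sum_congr rfl fun b _ => by ring
  have h0 : 0 ≤ x ⬝ᵥ x := Finset.sum_nonneg fun i _ => mul_self_nonneg _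
  rw [h, Real.sqrt_sq h0]

theorem isHermitian_vecMulVec_self {p : ℕ} (x : Fin p → ℝ) :
    (Matrix.vecMulVec x x).IsHermitian := by
  ext a b
  simp [Matrix.vecMulVec_apply, mul_comm]

/-- The form is a full contraction with xxᵀ in mode k. As xxᵀ has rank one, that mode contributes no
factor √m_k. -/
theorem abs_dotProduct_powerUpdate_le (hr : 0 < r) (F : Op n n)
    {B : (k : Fin r) → Matrix (Fin (n k)) (Fin (n k)) ℝ} (hB : IsFeasible m B) (k : Fin r)
    (x : Fin (n k) → ℝ) :
    |x ⬝ᵥ (powerUpdate F B k *ᵥ x)| ≤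
      mlNorm F * (∏ l ∈ Finset.univ.erase k, Real.sqrt (m l)) * (x ⬝ᵥ x) := by
  rw [dotProduct_powerUpdate_mulVec]
  have h := abs_signalHat_le hr F (C := Function.update B k (Matrix.vecMulVec x x))
    (d := Function.update m k 1) ?_ ?_
  · refine h.trans_eq ?_
    rw [← Finset.mul_prod_erase _ _ (Finset.mem_univ k), Function.update_self,
      Function.update_self, frob_vecMulVec_self]
    have h1 : ∏ l ∈ Finset.univ.erase k, (Real.sqrt (Function.update m k 1 l) *
        frob (Function.update B k (Matrix.vecMulVec x x) l)) =
        ∏ l ∈ Finset.univ.erase k, Real.sqrt (m l) := by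
      refine Finset.prod_congr rfl fun l hl => ?_
      rw [Function.update_of_ne (Finset.ne_of_mem_erase hl),
        Function.update_of_ne (Finset.ne_of_mem_erase hl), (hB l).2.2, mul_one]
    rw [h1]
    simp
    ring
  · intro l
    rcases eq_or_ne l k with rfl | hl
    · rw [Function.update_self]
      exact isHermitian_vecMulVec_self x
    · rw [Function.update_of_ne hl]
      exact (hB l).1.1
  · intro l
    rcases eq_or_ne l k with rfl | hl
    · rw [Function.update_self, Function.update_self]
      exact Matrix.rank_vecMulVec_le _ _
    · rw [Function.update_of_ne hl, Function.update_of_ne hl]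
      exact (hB l).2.1

/-- The truncated update is close to a multiple of the signal. -/
theorem frob_eigTrunc_powerUpdate_sub_le (hr : 0 < r)
    {G : (k : Fin r) → Matrix (Fin (n k)) (Fin (n k)) ℝ} (hG : ∀ k, (G k).PosSemidef)
    (hGm : ∀ k, (G k).rank ≤ m k) {F : Op n n} {ψ : ℝ} (hψ : mlNorm F ≤ ψ) (hψ0 : 0 ≤ ψ)
    {B : (k : Fin r) → Matrix (Fin (n k)) (Fin (n k)) ℝ} (hB : IsFeasible m B) (k : Fin r)
    (hc : 0 ≤ ∏ l ∈ Finset.univ.erase k, (inner ℝ (vec (B l)) (vec (G l)) : ℝ))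
    {E : Matrix (Fin (n k)) (Fin (n k)) ℝ}
    (hE : IsEigTrunc (m k) (powerUpdate (tucker G + F) B k) E) :
    frob (E - (∏ l ∈ Finset.univ.erase k, (inner ℝ (vec (B l)) (vec (G l)) : ℝ)) • G k) ≤
      2 * Real.sqrt 2 * (Real.sqrt (∏ l, (m l : ℝ)) * ψ) := by
  set P := ∏ l ∈ Finset.univ.erase k, Real.sqrt (m l)
  have hP : 0 ≤ P := Finset.prod_nonneg fun _ _ => Real.sqrt_nonneg _
  -- The perturbation has size ψ∏√m_l over l ≠ k; the missing √m_k comes from the rank bound in the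
  -- truncation.
  have h := hE.frob_sub_le ((hG k).smul hc) ((rank_smul_le _ _).trans (hGm k))
    (e := ψ * P) (by positivity) ?_
  · refine h.trans_eq ?_
    have h1 : Real.sqrt (∏ l, (m l : ℝ)) = Real.sqrt (m k) * P := by
      rw [Real.sqrt_prod _ fun _ _ => Nat.cast_nonneg _,
        Finset.mul_prod_erase _ (fun l => Real.sqrt (m l)) (Finset.mem_univ k)]
    rw [h1, Real.sqrt_mul (by norm_num)]
    ring
  · intro x
    rw [powerUpdate_add, powerUpdate_tucker, add_sub_cancel_left]
    refine (abs_dotProduct_powerUpdate_le hr F hB k x).trans ?_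
    have : 0 ≤ x ⬝ᵥ x := Finset.sum_nonneg fun i _ => mul_self_nonneg _
    gcongr

/-- The inner product is tr(AᵀBA). Its sign keeps the initial angle at most π/2, so that a bound on
the sine yields a lower bound on the cosine. -/
theorem inner_vec_gram_nonneg (A : (k : Fin r) → Matrix (Fin (n k)) (Fin (m k)) ℝ) (k : Fin r)
    {B : Matrix (Fin (n k)) (Fin (n k)) ℝ} (hB : B.PosSemidef) :
    0 ≤ (inner ℝ (vec B) (vec (gram A k)) : ℝ) := by
  have h1 := (hB.conjTranspose_mul_mul_same (A k)).trace_nonneg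
  refine h1.trans_eq ?_
  rw [inner_vec, Matrix.mul_assoc, Matrix.trace_mul_comm, Matrix.mul_assoc]
  simp only [Matrix.trace, Matrix.diag, Matrix.mul_apply (M := B)]
  refine Finset.sum_congr rfl fun a _ => Finset.sum_congr rfl fun b _ => ?_
  congr 1
  simp [gram, Matrix.mul_apply, mul_comm]

theorem sqrt_le_inner_of_sin_initAngle_le (A : (k : Fin r) → Matrix (Fin (n k)) (Fin (m k)) ℝ)
    (k : Fin r) {B : Matrix (Fin (n k)) (Fin (n k)) ℝ} (hB : B.PosSemidef) (hB1 : frob B = 1)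
    (hG : 0 < frob (gram A k)) {τ : ℝ} (h : Real.sin (initAngle A k B) ≤ τ) :
    frob (gram A k) * Real.sqrt (1 - τ ^ 2) ≤ inner ℝ (vec B) (vec (gram A k)) := by
  have hcos : Real.cos (initAngle A k B) * frob (gram A k) =
      inner ℝ (vec B) (vec (gram A k)) := by
    rw [initAngle, InnerProductGeometry.angle_smul_left_of_pos _ _ (inv_pos.2 hG),
      InnerProductGeometry.cos_angle, show ‖vec B‖ = 1 from hB1, mul_one, real_inner_comm]
    exact div_mul_cancel₀ _ hG.ne'
  have hcos0 : 0 ≤ Real.cos (initAngle A k B) :=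
    nonneg_of_mul_nonneg_left (hcos ▸ inner_vec_gram_nonneg A k hB) hG
  rw [← hcos, mul_comm]
  refine mul_le_mul_of_nonneg_right ?_ hG.le
  rw [Real.sqrt_le_left hcos0]
  have h1 := Real.sin_sq_add_cos_sq (initAngle A k B)
  have h2 : 0 ≤ Real.sin (initAngle A k B) := InnerProductGeometry.sin_angle_nonneg _ _
  nlinarith

theorem gram_posSemidef (A : (k : Fin r) → Matrix (Fin (n k)) (Fin (m k)) ℝ) (k : Fin r) :
    (gram A k).PosSemidef := by
  simpa [gram] using Matrix.posSemidef_self_mul_conjTranspose (A k)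

theorem rank_gram_le (A : (k : Fin r) → Matrix (Fin (n k)) (Fin (m k)) ℝ) (k : Fin r) :
    (gram A k).rank ≤ m k := by
  refine (Matrix.rank_mul_le_left _ _).trans ?_
  simpa using Matrix.rank_le_card_width (A k)

/-- One iteration brings each factor close to the direction of the signal. -/
theorem sqrt_le_inner_iterate (A : (k : Fin r) → Matrix (Fin (n k)) (Fin (m k)) ℝ)
    (hr : 0 < r) (hG : ∀ k, 0 < frob (gram A k)) {F : Op n n} {ψ : ℝ} (hψ : mlNorm F ≤ ψ)
    (hψ0 : 0 ≤ ψ) {τ s : ℝ} (hτ0 : 0 < 1 - τ ^ 2)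
    {B B' : (k : Fin r) → Matrix (Fin (n k)) (Fin (n k)) ℝ} (hB : IsFeasible m B)
    (hsin : ∀ k, Real.sin (initAngle A k (B k)) ≤ τ)
    (hit : IsIteration m (tucker (gram A) + F) B B') (hs0 : 0 ≤ s) (hs1 : s < 1)
    (hs : 2 * Real.sqrt 2 * (Real.sqrt (∏ l, (m l : ℝ)) * ψ) ≤
      signal A * Real.sqrt (1 - τ ^ 2) ^ (r - 1) * s) (k : Fin r) :
    frob (B' k) = 1 ∧ (B' k).IsHermitian ∧ (B' k).rank ≤ m k ∧
      Real.sqrt (1 - s ^ 2) ≤ inner ℝ (vec (B' k)) ((frob (gram A k))⁻¹ • vec (gram A k)) := by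
  obtain ⟨E, hE, hB'⟩ := hit k
  set c := ∏ l ∈ Finset.univ.erase k, (inner ℝ (vec (B l)) (vec (gram A l)) : ℝ)
  set q := Real.sqrt (1 - τ ^ 2)
  have hq : 0 < q := Real.sqrt_pos.2 hτ0
  have hcge : ∏ l ∈ Finset.univ.erase k, (frob (gram A l) * q) ≤ c :=
    Finset.prod_le_prod (fun l _ => mul_nonneg (hG l).le hq.le) fun l _ =>
      sqrt_le_inner_of_sin_initAngle_le A l (hB l).1 (hB l).2.2 (hG l) (hsin l)
  have hcpos : 0 < c := (Finset.prod_pos fun l _ => mul_pos (hG l) hq).trans_le hcge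
  have hκ : signal A * q ^ (r - 1) ≤ c * frob (gram A k) := by
    refine le_trans (le_of_eq ?_) (mul_le_mul_of_nonneg_right hcge (hG k).le)
    rw [Finset.prod_mul_distrib, Finset.prod_const, Finset.card_erase_of_mem (Finset.mem_univ k),
      Finset.card_univ, Fintype.card_fin, signal, ← Finset.mul_prod_erase _ _ (Finset.mem_univ k)]
    ring
  have h1 := frob_eigTrunc_powerUpdate_sub_le hr (gram_posSemidef A) (rank_gram_le A) hψ hψ0 hB k
    hcpos.le hE
  set b := (frob (gram A k))⁻¹ • vec (gram A k) with hb
  have hbn : ‖b‖ = 1 := by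
    rw [hb, norm_smul, norm_inv, Real.norm_eq_abs, abs_of_pos (hG k)]
    exact inv_mul_cancel₀ (hG k).ne'
  have h2 : ‖vec E - (c * frob (gram A k)) • b‖ ≤ (c * frob (gram A k)) * s := by
    have : (c * frob (gram A k)) • b = c • vec (gram A k) := by
      rw [hb, smul_smul, mul_assoc, mul_inv_cancel₀ (hG k).ne', mul_one]
    rw [this]
    exact (h1.trans hs).trans (mul_le_mul_of_nonneg_right hκ hs0)
  obtain ⟨hE0, hin⟩ := sqrt_le_inner_of_norm_sub_le hbn (mul_pos hcpos (hG k)) hs0 hs1 h2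
  have hfE : frob E ≠ 0 := norm_ne_zero_iff.2 hE0
  refine ⟨?_, ?_, ?_, ?_⟩
  · rw [hB', frob_smul, abs_inv, abs_of_nonneg (frob_nonneg E), inv_mul_cancel₀ hfE]
  · rw [hB']
    exact hE.isHermitian.smul (IsSelfAdjoint.all _)
  · rw [hB']
    exact (rank_smul_le _ _).trans hE.rank_le
  · rw [hB', vec_smul]
    exact hin

end Step

/-! ### The deterministic error bound -/

section Deterministic

variable {r : ℕ} {n m : Fin r → ℕ}

theorem exists_gFun_pos_of_lt_tauOne {M ρ τ : ℝ} (hτ : 0 < τ) (h : τ < tauOne r M ρ) :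
    ∃ x, τ < x ∧ x < 1 ∧ 0 < gFun r M ρ x := by
  have hne : {x : ℝ | 0 < x ∧ x < 1 ∧ 0 < gFun r M ρ x}.Nonempty := by
    by_contra hne
    rw [Set.not_nonempty_iff_eq_empty] at hne
    -- `sSup ∅ = 0`, so 0 < τ < τ₁ forces the set to be nonempty.
    rw [tauOne, hne, Real.sSup_empty] at h
    exact absurd h hτ.not_gt
  obtain ⟨x, ⟨-, hx1, hxg⟩, hx⟩ := exists_lt_of_lt_csSup hne h
  exact ⟨x, hx, hx1, hxg⟩

/-- Identifies f₁ as twice the one-step error s. -/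
theorem f₁_eq {M ρ τ : ℝ} (hr : 1 ≤ r) (hτ : 0 ≤ 1 - τ ^ 2) :
    f₁ r M ρ τ = 2 * (2 * Real.sqrt 2 * (Real.sqrt M * ρ) / Real.sqrt (1 - τ ^ 2) ^ (r - 1)) := by
  have h : (1 - τ ^ 2) ^ (((r : ℝ) - 1) / 2) = Real.sqrt (1 - τ ^ 2) ^ (r - 1) := by
    rw [Real.sqrt_eq_rpow, ← Real.rpow_natCast _ (r - 1), ← Real.rpow_mul hτ, Nat.cast_sub hr]
    congr 1
    push_cast
    ring
  rw [f₁, h, Real.sqrt_mul (by norm_num)]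
  ring

/-- The smallness of the one-step error `s`, and its consequences for `ω̂`. -/
theorem stepError_bounds (hr : 2 ≤ r) {M ρ τ q s : ℝ} (hM : 0 ≤ M) (hτ : 0 < τ)
    (hτ₁ : τ < tauOne r M ρ) (hq : q = Real.sqrt (1 - τ ^ 2) ^ (r - 1))
    (hs : s = 2 * Real.sqrt 2 * (Real.sqrt M * ρ) / q) :
    0 < 1 - τ ^ 2 ∧ s < 1 ∧ s ^ 2 ≤ 1 ∧ Real.sqrt M * ρ ≤ Real.sqrt (1 - s ^ 2) ^ r ∧
      r / 2 * s ^ 2 + ρ * Real.sqrt M ≤ f₂ r M ρ τ := by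
  obtain ⟨x, hx, hx1, hxg⟩ := exists_gFun_pos_of_lt_tauOne hτ hτ₁
  have hτ1 : 0 < 1 - τ ^ 2 := by nlinarith
  have hx0 : 0 < 1 - x ^ 2 := by nlinarith
  have hq2 : q ^ 2 = (1 - τ ^ 2) ^ (r - 1) := by
    rw [hq, ← pow_mul, mul_comm, pow_mul, Real.sq_sqrt hτ1.le]
  have hq0 : 0 < q := by rw [hq]; exact pow_pos (Real.sqrt_pos.2 hτ1) _
  set w := (1 - x ^ 2) ^ (r - 1) with hw
  have hw0 : 0 < w := pow_pos hx0 _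
  have hwq : w ≤ q ^ 2 := by
    rw [hq2]
    exact pow_le_pow_left₀ hx0.le (by nlinarith) _
  have hg : 32 * M * ρ ^ 2 < x ^ 2 * w := by
    rw [gFun] at hxg
    linarith
  have hs2 : s ^ 2 * q ^ 2 = 8 * (M * ρ ^ 2) := by
    rw [hs, div_pow, div_mul_cancel₀ _ (by positivity), mul_pow, mul_pow, mul_pow,
      Real.sq_sqrt (by norm_num), Real.sq_sqrt hM]
    ring
  -- Here x > τ has g(x) > 0; s²q² = 8Mρ² is a quarter of the 32Mρ² in g, and (1-x²)^(r-1) ≤ q². In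
  -- particular s² < 1/4.
  have hsx : s ^ 2 ≤ x ^ 2 / 4 := by
    have h1 : s ^ 2 * q ^ 2 ≤ x ^ 2 / 4 * q ^ 2 := by
      rw [hs2]
      nlinarith [mul_le_mul_of_nonneg_left hwq (sq_nonneg x)]
    exact le_of_mul_le_mul_right h1 (by positivity)
  have hxx : x ^ 2 < 1 := by linarith
  have hs4 : s ^ 2 ≤ 1 / 4 := by linarith
  refine ⟨hτ1, by nlinarith, by linarith, ?_, ?_⟩
  · refine abs_le_of_sq_le_sq' ?_ (pow_nonneg (Real.sqrt_nonneg _) _) |>.2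
    rw [← pow_mul, mul_comm r, pow_mul, Real.sq_sqrt (by linarith), mul_pow, Real.sq_sqrt hM]
    have h1 : w ≤ (1 - s ^ 2) ^ (r - 1) := pow_le_pow_left₀ hx0.le (by nlinarith [sq_nonneg x]) _
    have h2 : (1 - s ^ 2) ^ r = (1 - s ^ 2) ^ (r - 1) * (1 - s ^ 2) := by
      rw [← pow_succ, Nat.sub_add_cancel (by omega)]
    rw [h2]
    have h3 : w * (3 / 4) ≤ (1 - s ^ 2) ^ (r - 1) * (1 - s ^ 2) :=
      mul_le_mul h1 (by linarith) (by norm_num) (hw0.le.trans h1)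
    nlinarith
  · rw [f₂, ← hq2]
    have h1 : ρ ^ 2 * (16 * M * (r : ℝ) / q ^ 2) = 2 * r * s ^ 2 := by
      have : s ^ 2 = 8 * (M * ρ ^ 2) / q ^ 2 := by rw [← hs2]; field_simp
      rw [this]
      ring
    rw [h1]
    have : 0 ≤ (r : ℝ) * s ^ 2 := by positivity
    linarith

/-- The ratio ω̂/ω is the product of the r cosines plus a noise term. Bernoulli's inequality bounds
the product below by 1 - (r/2)s²; the smallness hypothesis keeps the ratio nonnegative, so that its
r-th root is meaningful. -/
theorem abs_signalHat_div_sub_one_le (A : (k : Fin r) → Matrix (Fin (n k)) (Fin (m k)) ℝ)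
    (hr : 2 ≤ r) (hG : ∀ k, 0 < frob (gram A k)) {F : Op n n} {ψ : ℝ} (hψ : mlNorm F ≤ ψ)
    {s : ℝ} (hs : s ^ 2 ≤ 1)
    (hsmall : Real.sqrt (∏ k, (m k : ℝ)) * (ψ / signal A) ≤ Real.sqrt (1 - s ^ 2) ^ r)
    {B : (k : Fin r) → Matrix (Fin (n k)) (Fin (n k)) ℝ}
    (hB : ∀ k, frob (B k) = 1 ∧ (B k).IsHermitian ∧ (B k).rank ≤ m k ∧
      Real.sqrt (1 - s ^ 2) ≤ inner ℝ (vec (B k)) ((frob (gram A k))⁻¹ • vec (gram A k))) :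
    0 ≤ signalHat (tucker (gram A) + F) B / signal A ∧
      |signalHat (tucker (gram A) + F) B / signal A - 1| ≤
        r / 2 * s ^ 2 + ψ / signal A * Real.sqrt (∏ k, (m k : ℝ)) := by
  have hω : 0 < signal A := Finset.prod_pos fun k _ => hG k
  set c : Fin r → ℝ := fun k => inner ℝ (vec (B k)) ((frob (gram A k))⁻¹ • vec (gram A k)) with hc
  have hF : |signalHat F B| ≤ ψ * Real.sqrt (∏ k, (m k : ℝ)) := by
    refine (abs_signalHat_le (by omega) F (fun k => (hB k).2.1) fun k => (hB k).2.2.1).trans ?_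
    simp only [fun k => (hB k).1, mul_one]
    rw [Real.sqrt_prod _ fun _ _ => Nat.cast_nonneg _]
    exact mul_le_mul_of_nonneg_right hψ (Finset.prod_nonneg fun _ _ => Real.sqrt_nonneg _)
  have hsig : signalHat (tucker (gram A) + F) B / signal A =
      ∏ k, c k + signalHat F B / signal A := by
    rw [signalHat_add, add_div, signalHat_tucker, signal, ← Finset.prod_div_distrib]
    congr 1
    refine Finset.prod_congr rfl fun k _ => ?_
    rw [hc]
    simp only [inner_smul_right]
    rw [inv_mul_eq_div]
  have hc1 : ∀ k, c k ≤ 1 := by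
    intro k
    refine (real_inner_le_norm _ _).trans ?_
    rw [show ‖vec (B k)‖ = 1 from (hB k).1, norm_smul, norm_inv, Real.norm_eq_abs,
      abs_of_pos (hG k), one_mul]
    exact (inv_mul_cancel₀ (hG k).ne').le
  have hc0 : ∀ k, 0 ≤ c k := fun k => (Real.sqrt_nonneg _).trans (hB k).2.2.2
  have hup : ∏ k, c k ≤ 1 := Finset.prod_le_one (fun k _ => hc0 k) fun k _ => hc1 k
  have hlow : Real.sqrt (1 - s ^ 2) ^ r ≤ ∏ k, c k := by
    have := Finset.prod_le_prod (s := Finset.univ) (f := fun _ : Fin r => Real.sqrt (1 - s ^ 2))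
      (g := c) (fun _ _ => Real.sqrt_nonneg _) fun k _ => (hB k).2.2.2
    simpa using this
  have hF' : |signalHat F B / signal A| ≤ ψ / signal A * Real.sqrt (∏ k, (m k : ℝ)) := by
    rw [abs_div, abs_of_pos hω, div_mul_eq_mul_div]
    gcongr
  have hbern := one_sub_le_sqrt_pow hr hs
  have h1 := abs_le.1 hF'
  rw [hsig]
  refine ⟨by linarith, abs_le.2 ⟨by linarith, ?_⟩⟩
  have : 0 ≤ (r : ℝ) / 2 * s ^ 2 := by positivity
  linarith

theorem frob_gram_pos (A : (k : Fin r) → Matrix (Fin (n k)) (Fin (m k)) ℝ)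
    (hsignal : 0 < signal A) (k : Fin r) : 0 < frob (gram A k) :=
  (frob_nonneg _).lt_of_ne' fun h0 =>
    hsignal.ne' (Finset.prod_eq_zero (Finset.mem_univ k) h0)

theorem abs_trace_tucker_gramHat_sub_le (A : (k : Fin r) → Matrix (Fin (n k)) (Fin (m k)) ℝ)
    (hr : 2 ≤ r) (hscale : ∀ k l, frob (gram A k) = frob (gram A l)) (hsignal : 0 < signal A)
    {F : Op n n} {ψ : ℝ} (hψ : mlNorm F ≤ ψ) (hψ0 : 0 ≤ ψ) {τ : ℝ} (hτ : 0 < τ)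
    (hτ₁ : τ < tauOne r (∏ k, (m k : ℝ)) (ψ / signal A))
    {B B' : (k : Fin r) → Matrix (Fin (n k)) (Fin (n k)) ℝ} (hB : IsFeasible m B)
    (hsin : ∀ k, Real.sin (initAngle A k (B k)) ≤ τ)
    (hit : IsIteration m (tucker (gram A) + F) B B') :
    |(tucker (gramHat (tucker (gram A) + F) B')).trace - (tucker (gram A)).trace| ≤
      Real.sqrt (∏ k, (m k : ℝ)) * signal A *
        ((1 + 2 * f₁ r (∏ k, (m k : ℝ)) (ψ / signal A) τ
          + Real.sqrt 2 * f₂ r (∏ k, (m k : ℝ)) (ψ / signal A) τ) ^ r - 1) := by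
  have hG := frob_gram_pos A hsignal
  set β := frob (gram A ⟨0, by omega⟩) with hβ
  have hGβ : ∀ k, frob (gram A k) = β := fun k => hscale k _
  have hβ0 : 0 < β := hG _
  have hωβ : signal A = β ^ r := by simp [signal, hGβ]
  set M := ∏ k, (m k : ℝ) with hMdef
  have hM : 0 ≤ M := Finset.prod_nonneg fun _ _ => Nat.cast_nonneg _
  set ρ := ψ / signal A with hρ
  have hρ0 : 0 ≤ ρ := by positivity
  set q := Real.sqrt (1 - τ ^ 2) ^ (r - 1) with hq
  set s := 2 * Real.sqrt 2 * (Real.sqrt M * ρ) / q with hs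
  obtain ⟨hτ1, hs1, hs2, hsmall, hf2⟩ := stepError_bounds hr hM hτ hτ₁ hq hs
  have hq0 : 0 < q := pow_pos (Real.sqrt_pos.2 hτ1) _
  have hs0 : 0 ≤ s := by positivity
  have hf1 : f₁ r M ρ τ = 2 * s := f₁_eq (by omega) hτ1.le
  have hstep := sqrt_le_inner_iterate A (by omega) hG hψ hψ0 hτ1 hB hsin hit hs0 hs1 <| by
    rw [← hq, hs, hρ]
    refine le_of_eq ?_
    field_simp
    rw [← hMdef, mul_comm]
  obtain ⟨ht0, ht⟩ := abs_signalHat_div_sub_one_le A hr hG hψ hs2 hsmall hstep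
  replace ht := ht.trans hf2
  set t := signalHat (tucker (gram A) + F) B' / signal A with htdef
  -- Equal scaling enters here: ω = β^r, so ω̂^(1/r) is β times the root of ω̂/ω for every mode at
  -- once.
  have hroot : signalHat (tucker (gram A) + F) B' ^ (1 / (r : ℝ)) = β * t ^ (1 / (r : ℝ)) := by
    have h1 : signalHat (tucker (gram A) + F) B' = β ^ r * t := by
      rw [htdef, ← hωβ, mul_div_cancel₀ _ hsignal.ne']
    rw [h1, Real.mul_rpow (by positivity) ht0, one_div, Real.pow_rpow_inv_natCast hβ0.le (by omega)]
  have hf20 : 0 ≤ f₂ r M ρ τ := (abs_nonneg _).trans ht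
  have hfrob : ∀ k, frob (gramHat (tucker (gram A) + F) B' k - gram A k) ≤
      β * (Real.sqrt 2 * s + f₂ r M ρ τ) := by
    intro k
    obtain ⟨hn, -, -, hin⟩ := hstep k
    rw [hGβ] at hin
    have hbn : ‖β⁻¹ • vec (gram A k)‖ = 1 := by
      rw [norm_smul, norm_inv, Real.norm_eq_abs, abs_of_pos hβ0, show ‖vec (gram A k)‖ = β from
        hGβ k, inv_mul_cancel₀ hβ0.ne']
    have h1 := norm_sub_le_sqrt_two_mul hn hbn hs0 hs1 hin
    have h2 : vec (gramHat (tucker (gram A) + F) B' k - gram A k) =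
        β • ((t ^ (1 / (r : ℝ)) - 1) • vec (B' k) + (vec (B' k) - β⁻¹ • vec (gram A k))) := by
      rw [gramHat, vec_sub, vec_smul, hroot, smul_add, smul_sub, smul_smul, smul_smul,
        mul_inv_cancel₀ hβ0.ne', one_smul, mul_sub, sub_smul, mul_one]
      abel
    rw [frob, h2, norm_smul, Real.norm_eq_abs, abs_of_pos hβ0]
    refine mul_le_mul_of_nonneg_left ?_ hβ0.le
    refine (norm_add_le _ _).trans ?_
    rw [norm_smul, show ‖vec (B' k)‖ = 1 from hn, mul_one, Real.norm_eq_abs, add_comm]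
    exact add_le_add h1 ((abs_rpow_inv_sub_one_le (by omega) ht0).trans ht)
  set η := 2 * f₁ r M ρ τ + Real.sqrt 2 * f₂ r M ρ τ with hη
  have hη0 : 0 ≤ η := by rw [hη, hf1]; positivity
  have htr : ∀ k, |(gramHat (tucker (gram A) + F) B' k).trace - (gram A k).trace| ≤
      Real.sqrt (m k) * β * η := by
    intro k
    rw [← Matrix.trace_sub]
    have hherm : (gramHat (tucker (gram A) + F) B' k - gram A k).IsHermitian :=
      ((hstep k).2.1.smul (IsSelfAdjoint.all _)).sub (gram_posSemidef A k).1
    have hrank : (gramHat (tucker (gram A) + F) B' k - gram A k).rank ≤ 2 * m k := by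
      have h1 : gramHat (tucker (gram A) + F) B' k - gram A k =
          signalHat (tucker (gram A) + F) B' ^ (1 / (r : ℝ)) • B' k + (-1 : ℝ) • gram A k := by
        simp [gramHat, sub_eq_add_neg]
      rw [h1]
      have h2 := matrix_rank_add_le (signalHat (tucker (gram A) + F) B' ^ (1 / (r : ℝ)) • B' k)
        ((-1 : ℝ) • gram A k)
      have h3 := (rank_smul_le (signalHat (tucker (gram A) + F) B' ^ (1 / (r : ℝ))) (B' k)).trans
        (hstep k).2.2.1
      have h4 := (rank_smul_le (-1) (gram A k)).trans (rank_gram_le A k)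
      omega
    refine (abs_trace_le hherm hrank).trans ?_
    refine (mul_le_mul_of_nonneg_left (hfrob k) (Real.sqrt_nonneg _)).trans ?_
    push_cast
    rw [Real.sqrt_mul (by norm_num), hη, hf1]
    have h2 : Real.sqrt 2 * Real.sqrt 2 = 2 := Real.mul_self_sqrt (by norm_num)
    have h3 : Real.sqrt 2 * Real.sqrt (m k) * (β * (Real.sqrt 2 * s + f₂ r M ρ τ)) =
        Real.sqrt (m k) * β * ((Real.sqrt 2 * Real.sqrt 2) * s + Real.sqrt 2 * f₂ r M ρ τ) := by
      ring
    rw [h3, h2]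
    refine mul_le_mul_of_nonneg_left ?_ (by positivity)
    -- Only 2s is needed, whereas the bound allows 2f₁ = 4s.
    linarith
  rw [trace_tucker, trace_tucker]
  refine (abs_prod_sub_prod_le Finset.univ (Y := fun k => Real.sqrt (m k) * β) hη0 ?_ htr).trans ?_
  · intro k
    rw [← hGβ k]
    exact abs_trace_le (gram_posSemidef A k).1 (rank_gram_le A k)
  · rw [Finset.prod_mul_distrib, Finset.prod_const, Finset.card_univ, Fintype.card_fin, ← hωβ,
      hMdef, Real.sqrt_prod _ fun _ _ => Nat.cast_nonneg _, hη, add_assoc]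

end Deterministic

/-! ### Concentration of the squared norm of a Gaussian vector -/

section GaussianNorm

theorem integral_exp_mul_sq_gaussianReal {v : NNReal} {s : ℝ} (h : 2 * s * v < 1) :
    ∫ x, Real.exp (s * x ^ 2) ∂(gaussianReal 0 v) = (Real.sqrt (1 - 2 * s * v))⁻¹ := by
  rcases eq_or_ne v 0 with rfl | hv
  · simp
  have hv' : 0 < (v : ℝ) := NNReal.coe_pos.2 (pos_iff_ne_zero.2 hv)
  rw [integral_gaussianReal_eq_integral_smul hv]
  have h1 : ∀ x : ℝ, gaussianPDFReal 0 v x • Real.exp (s * x ^ 2) =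
      (Real.sqrt (2 * Real.pi * v))⁻¹ * Real.exp (-(1 / (2 * v) - s) * x ^ 2) := by
    intro x
    rw [gaussianPDFReal_def, smul_eq_mul, mul_assoc, ← Real.exp_add]
    congr 2
    field_simp
    ring
  simp only [h1]
  rw [integral_const_mul, integral_gaussian, ← Real.sqrt_inv, ← Real.sqrt_inv,
    ← Real.sqrt_mul (by positivity)]
  congr 1
  have h2 : 1 / (2 * (v : ℝ)) - s = (1 - 2 * s * v) / (2 * v) := by field_simp
  have h3 : 1 - 2 * s * (v : ℝ) ≠ 0 := by linarith
  rw [h2]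
  field_simp

variable {Ω : Type*} [MeasurableSpace Ω] {P : Measure Ω}

theorem mgf_sq_of_map_eq_gaussianReal {Y : Ω → ℝ} {v : NNReal} (hYm : AEMeasurable Y P)
    (hY : P.map Y = gaussianReal 0 v) {s : ℝ} (h : 2 * s * v < 1) :
    mgf (fun ω => Y ω ^ 2) P s = (Real.sqrt (1 - 2 * s * v))⁻¹ := by
  rw [← integral_exp_mul_sq_gaussianReal h, ← hY, integral_map hYm (by fun_prop)]
  rfl

variable [IsProbabilityMeasure P] {ι : Type*} [Fintype ι]

/-- The coordinates of a Gaussian vector in an orthonormal basis that diagonalizes its covariance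
are independent. -/
theorem iIndepFun_inner_of_gaussian {X : Ω → EuclideanSpace ℝ ι} (hXm : AEMeasurable X P)
    (b : OrthonormalBasis ι ℝ (EuclideanSpace ℝ ι)) {lam : ι → ℝ} (hlam : ∀ j, 0 ≤ lam j)
    (hX : ∀ T, P.map (fun ω => (inner ℝ (X ω) T : ℝ)) =
      gaussianReal 0 (Real.toNNReal (∑ j, lam j * inner ℝ (b j) T ^ 2))) :
    iIndepFun (fun j ω => (inner ℝ (X ω) (b j) : ℝ)) P := by
  classical
  have hgauss : HasGaussianLaw X P := by
    refine ⟨isGaussian_of_map_eq_gaussianReal fun L => ?_⟩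
    refine ⟨0, Real.toNNReal (∑ j, lam j *
      inner ℝ (b j) ((InnerProductSpace.toDual ℝ _).symm L) ^ 2), ?_⟩
    rw [← hX, AEMeasurable.map_map_of_aemeasurable (by fun_prop) hXm]
    congr 1
    ext ω
    rw [Function.comp_apply, real_inner_comm, InnerProductSpace.toDual_symm_apply]
  have hvar : ∀ T, Var[fun ω => (inner ℝ (X ω) T : ℝ); P] = ∑ j, lam j * inner ℝ (b j) T ^ 2 := by
    intro T
    have hm : AEMeasurable (fun ω => (inner ℝ (X ω) T : ℝ)) P := by fun_prop
    have h1 := variance_map (X := id) (μ := P) (Y := fun ω => (inner ℝ (X ω) T : ℝ))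
      (by fun_prop) hm
    rw [hX, variance_id_gaussianReal] at h1
    rw [Function.id_comp] at h1
    rw [← h1, Real.coe_toNNReal _ (Finset.sum_nonneg fun j _ => mul_nonneg (hlam j) (sq_nonneg _))]
  have hmem : ∀ T, MemLp (fun ω => (inner ℝ (X ω) T : ℝ)) 2 P := by
    intro T
    have := (hgauss.map_fun (innerSL ℝ T)).memLp_two
    simpa [real_inner_comm] using this
  refine HasGaussianLaw.iIndepFun_of_covariance_eq_zero ?_ ?_
  · have := hgauss.map_fun (ContinuousLinearMap.pi fun j => innerSL ℝ (b j))
    refine this.congr (Filter.EventuallyEq.of_eq ?_)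
    ext ω j
    simp [real_inner_comm]
  · intro i j hij
    -- Polarization: the variance form is diagonal in b, hence additive on b i + b j, and the
    -- covariance vanishes. For jointly Gaussian coordinates this is independence.
    have h1 := variance_add (hmem (b i)) (hmem (b j))
    have h2 : (fun ω => (inner ℝ (X ω) (b i) : ℝ)) + (fun ω => (inner ℝ (X ω) (b j) : ℝ)) =
        fun ω => inner ℝ (X ω) (b i + b j) := by
      ext ω
      simp [inner_add_right]
    rw [h2, hvar, hvar, hvar] at h1
    have h3 : ∑ k, lam k * (inner ℝ (b k) (b i + b j) : ℝ) ^ 2 =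
        ∑ k, lam k * (inner ℝ (b k) (b i) : ℝ) ^ 2 + ∑ k, lam k * (inner ℝ (b k) (b j) : ℝ) ^ 2 := by
      rw [← Finset.sum_add_distrib]
      refine Finset.sum_congr rfl fun k _ => ?_
      rw [inner_add_right, b.inner_eq_ite, b.inner_eq_ite]
      split_ifs with h4 h5
      · exact absurd (h4.symm.trans h5) hij
      all_goals ring
    linarith

theorem mgf_norm_sq_of_gaussian {X : Ω → EuclideanSpace ℝ ι} (hXm : AEMeasurable X P)
    (b : OrthonormalBasis ι ℝ (EuclideanSpace ℝ ι)) {lam : ι → ℝ} (hlam : ∀ j, 0 ≤ lam j)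
    (hX : ∀ T, P.map (fun ω => (inner ℝ (X ω) T : ℝ)) =
      gaussianReal 0 (Real.toNNReal (∑ j, lam j * inner ℝ (b j) T ^ 2)))
    {s : ℝ} (hs : ∀ j, 2 * s * lam j < 1) :
    mgf (fun ω => ‖X ω‖ ^ 2) P s = ∏ j, (Real.sqrt (1 - 2 * s * lam j))⁻¹ := by
  classical
  have hind := (iIndepFun_inner_of_gaussian hXm b hlam hX).comp (fun _ x => x ^ 2)
    fun _ => by fun_prop
  have h1 := hind.mgf_sum₀ (t := s) (fun j => by
    simp only [Function.comp_def]
    fun_prop) Finset.univ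
  have h2 : (∑ j, (fun x : ℝ => x ^ 2) ∘ fun ω => (inner ℝ (X ω) (b j) : ℝ)) =
      fun ω => ‖X ω‖ ^ 2 := by
    ext ω
    rw [Finset.sum_apply, ← b.sum_sq_norm_inner_left (X ω)]
    simp
  rw [h2] at h1
  rw [h1]
  refine Finset.prod_congr rfl fun j _ => ?_
  have h3 : ∑ k, lam k * (inner ℝ (b k) (b j) : ℝ) ^ 2 = lam j := by
    simp [b.inner_eq_ite]
  have h4 := hX (b j)
  rw [h3] at h4
  have h5 := mgf_sq_of_map_eq_gaussianReal (s := s) (by fun_prop) h4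
    (by rw [Real.coe_toNNReal _ (hlam j)]; exact hs j)
  rw [Real.coe_toNNReal _ (hlam j)] at h5
  exact h5

theorem inv_sqrt_one_sub_le_exp {K y : ℝ} (hy : y < 1)
    (hK : -Real.log (1 - y) ≤ y + K * y ^ 2) :
    (Real.sqrt (1 - y))⁻¹ ≤ Real.exp (y / 2 + K * y ^ 2 / 2) := by
  rw [← Real.log_le_iff_le_exp (inv_pos.2 (Real.sqrt_pos.2 (by linarith))), Real.log_inv,
    Real.log_sqrt (by linarith)]
  linarith

/-- The moment generating function of the summed squared norms of independent Gaussian vectors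
with the same covariance. -/
theorem integrable_and_mgf_sum_norm_sq_le {N : ℕ} {X : Fin N → Ω → EuclideanSpace ℝ ι}
    (hXm : ∀ i, AEMeasurable (X i) P) (hind : iIndepFun X P)
    (b : OrthonormalBasis ι ℝ (EuclideanSpace ℝ ι)) {lam : ι → ℝ} (hlam : ∀ j, 0 ≤ lam j)
    (hX : ∀ i T, P.map (fun ω => (inner ℝ (X i ω) T : ℝ)) =
      gaussianReal 0 (Real.toNNReal (∑ j, lam j * inner ℝ (b j) T ^ 2)))
    {s K : ℝ} (hs : ∀ j, 2 * s * lam j < 1)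
    (hK : ∀ j, -Real.log (1 - 2 * s * lam j) ≤ 2 * s * lam j + K * (2 * s * lam j) ^ 2) :
    Integrable (fun ω => Real.exp (s * ∑ i, ‖X i ω‖ ^ 2)) P ∧
      mgf (fun ω => ∑ i, ‖X i ω‖ ^ 2) P s ≤
        Real.exp (N * (s * ∑ j, lam j + 2 * K * s ^ 2 * ∑ j, lam j ^ 2)) := by
  have hind' := hind.comp (fun _ x => ‖x‖ ^ 2) fun _ => by fun_prop
  have h1 := hind'.mgf_sum₀ (t := s) (fun i => by
    simp only [Function.comp_def]
    fun_prop) Finset.univ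
  have h2 : (∑ i, (fun x : EuclideanSpace ℝ ι => ‖x‖ ^ 2) ∘ X i) =
      fun ω => ∑ i, ‖X i ω‖ ^ 2 := by
    ext ω
    simp
  rw [h2] at h1
  have h3 : ∀ i, mgf ((fun x : EuclideanSpace ℝ ι => ‖x‖ ^ 2) ∘ X i) P s =
      ∏ j, (Real.sqrt (1 - 2 * s * lam j))⁻¹ := fun i =>
    mgf_norm_sq_of_gaussian (hXm i) b hlam (hX i) hs
  simp only [h3, Finset.prod_const, Finset.card_univ, Fintype.card_fin] at h1
  have hpos : ∀ j, 0 < (Real.sqrt (1 - 2 * s * lam j))⁻¹ := fun j =>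
    inv_pos.2 (Real.sqrt_pos.2 (by linarith [hs j]))
  have hprod : 0 < ∏ j, (Real.sqrt (1 - 2 * s * lam j))⁻¹ := Finset.prod_pos fun j _ => hpos j
  -- A non-integrable function has integral 0 by convention, so the positive value of the integral
  -- already proves integrability.
  refine ⟨Integrable.of_integral_ne_zero ?_, ?_⟩
  · have : (∫ ω, Real.exp (s * ∑ i, ‖X i ω‖ ^ 2) ∂P) =
      (∏ j, (Real.sqrt (1 - 2 * s * lam j))⁻¹) ^ N := h1
    rw [this]
    positivity
  · rw [h1, Real.exp_nat_mul]
    refine pow_le_pow_left₀ hprod.le ?_ N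
    refine (Finset.prod_le_prod (fun j _ => (hpos j).le) fun j _ =>
      inv_sqrt_one_sub_le_exp (hs j) (hK j)).trans_eq ?_
    rw [← Real.exp_sum, Finset.sum_add_distrib, Finset.mul_sum, Finset.mul_sum]
    congr 1
    congr 1 <;> exact Finset.sum_congr rfl fun j _ => by ring

/-- By the power series, (-log(1-y) - y)/y² is at most its value at y = 1/2, which is 4 log 2 - 2.
-/
theorem neg_log_one_sub_le {y : ℝ} (hy0 : 0 ≤ y) (hy : y ≤ 1 / 2) :
    -Real.log (1 - y) ≤ y + (4 * Real.log 2 - 2) * y ^ 2 := by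
  have h1 := Real.hasSum_pow_div_log_of_abs_lt_one (x := y) (by rw [abs_of_nonneg hy0]; linarith)
  have h2 := Real.hasSum_pow_div_log_of_abs_lt_one (x := 1 / 2)
    (by rw [abs_of_nonneg] <;> norm_num)
  have h1' := (hasSum_nat_add_iff' 1).2 h1
  have h2' := ((hasSum_nat_add_iff' 1).2 h2).mul_left (4 * y ^ 2)
  have h3 := hasSum_le (fun k => ?_) h1' h2'
  · have h4 : Real.log (1 - 1 / 2) = -Real.log 2 := by
      rw [← Real.log_inv]
      norm_num
    rw [h4] at h3
    simp at h3
    linarith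
  · rw [← mul_div_assoc]
    gcongr
    have h4 : y ^ k ≤ (1 / 2) ^ k := pow_le_pow_left₀ hy0 hy k
    calc y ^ (k + 1 + 1) = y ^ 2 * y ^ k := by ring
      _ ≤ y ^ 2 * (1 / 2) ^ k := by gcongr
      _ = 4 * y ^ 2 * (1 / 2) ^ (k + 1 + 1) := by ring

theorem neg_log_one_add_le {y : ℝ} (hy : y ≤ 0) :
    -Real.log (1 - y) ≤ y + 1 / 2 * y ^ 2 := by
  have h := Real.le_log_one_add_of_nonneg (x := -y) (by linarith)
  have h1 : -y - 1 / 2 * y ^ 2 ≤ 2 * -y / (-y + 2) := by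
    rw [le_div_iff₀ (by linarith)]
    nlinarith [mul_nonneg (neg_nonneg.2 hy) (sq_nonneg y)]
  rw [← sub_eq_add_neg] at h
  linarith

end GaussianNorm

/-! ### Tail bounds -/

section Tail

theorem exp_neg_add_exp_neg_le_one {a b a₀ b₀ : ℝ} (ha₀ : 0 ≤ a₀) (hb₀ : 0 ≤ b₀) (ha : a₀ ≤ a)
    (hb : b₀ ≤ b) (h : 1 / (1 + a₀ + a₀ ^ 2 / 2) + 1 / (1 + b₀ + b₀ ^ 2 / 2) ≤ 1) :
    Real.exp (-a) + Real.exp (-b) ≤ 1 := by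
  have key : ∀ {c c₀ : ℝ}, 0 ≤ c₀ → c₀ ≤ c → Real.exp (-c) ≤ 1 / (1 + c₀ + c₀ ^ 2 / 2) := by
    intro c c₀ h0 hc
    rw [Real.exp_neg, ← one_div]
    exact one_div_le_one_div_of_le (by positivity)
      ((Real.quadratic_le_exp_of_nonneg h0).trans (Real.exp_le_exp.2 hc))
  exact (add_le_add (key ha₀ ha) (key hb₀ hb)).trans h

/-- The surpluses a₀, b₀ over 2ℓ pay for adding two tails without a factor 2; a quadratic lower
bound on exp reduces the check to rational arithmetic. -/
theorem exp_tails_le_of_exponents {u v ℓ a₀ b₀ : ℝ} (ha₀ : 0 ≤ a₀) (hb₀ : 0 ≤ b₀)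
    (hu : 2 * ℓ + a₀ ≤ u) (hv : 2 * ℓ + b₀ ≤ v)
    (h : 1 / (1 + a₀ + a₀ ^ 2 / 2) + 1 / (1 + b₀ + b₀ ^ 2 / 2) ≤ 1) :
    Real.exp (-u) + Real.exp (-v) ≤ Real.exp (-(2 * ℓ)) := by
  have h1 := exp_neg_add_exp_neg_le_one ha₀ hb₀ (a := u - 2 * ℓ) (b := v - 2 * ℓ) (by linarith)
    (by linarith) h
  have h2 : Real.exp (-u) = Real.exp (-(2 * ℓ)) * Real.exp (-(u - 2 * ℓ)) := by
    rw [← Real.exp_add]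
    ring_nf
  have h3 : Real.exp (-v) = Real.exp (-(2 * ℓ)) * Real.exp (-(v - 2 * ℓ)) := by
    rw [← Real.exp_add]
    ring_nf
  rw [h2, h3, ← mul_add]
  exact mul_le_of_le_one_right (Real.exp_pos _).le h1

/-- The two Chernoff exponents, at the deviation `max {α, √α}`, together give at most `d⁻²`. -/
theorem exists_exp_tails_le {d : ℕ} (hd : 2 ≤ d) {Q α : ℝ} (hQ : 0 < Q) (hQd : Q ≤ d)
    (hα : 0.145 * (Q * α) = 2 * Real.log d) :
    ∃ y, 0 ≤ y ∧ y ≤ 1 / 2 ∧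
      Real.exp (-(Q * (y * maxSqrt α / 2 - (4 * Real.log 2 - 2) * y ^ 2 / 2))) +
        Real.exp (-(Q * (maxSqrt α ^ 2 / 4))) ≤ Real.exp (-(2 * Real.log d)) := by
  have hl2 := Real.log_two_gt_d9
  have hl2' := Real.log_two_lt_d9
  have hlog : ∀ j : ℕ, 2 ^ j ≤ d → j * Real.log 2 ≤ Real.log d := by
    intro j hj
    rw [← Real.log_pow]
    exact Real.log_le_log (by positivity) (by exact_mod_cast hj)
  have hℓ1 : Real.log 2 ≤ Real.log d := by simpa using hlog 1 (by simpa using hd)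
  have hα0 : 0 < α := by
    by_contra h
    have := mul_nonpos_of_nonneg_of_nonpos hQ.le (not_lt.1 h)
    linarith
  set ℓ := Real.log d
  have hQα : Q * α = 400 / 29 * ℓ := by linarith
  rcases le_total α 1 with h1 | h1
  · have hx : maxSqrt α = Real.sqrt α := by
      rw [maxSqrt, max_eq_right]
      exact Real.le_sqrt_of_sq_le (by nlinarith)
    have hsq : Real.sqrt α ^ 2 = α := Real.sq_sqrt hα0.le
    have hs1 : Real.sqrt α ≤ 1 := Real.sqrt_le_one.2 h1
    have hd8 : 8 ≤ d := by
      have h2 : Q * α ≤ d := by nlinarith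
      have h3 : (8 : ℝ) ≤ d := by linarith
      exact_mod_cast h3
    have hℓ3 := hlog 3 (by simpa using hd8)
    push_cast at hℓ3
    -- This y gives the exponent Qα(1 - log 2)/2 ≈ 0.153 Qα. The margin over 0.145 Qα = 2ℓ provides
    -- the surplus, once d ≥ 8.
    refine ⟨Real.sqrt α / 2, by positivity, by linarith, ?_⟩
    rw [hx]
    refine exp_tails_le_of_exponents (a₀ := 0.23) (b₀ := 3) (by norm_num) (by norm_num) ?_ ?_
      (by norm_num)
    · have h2 : Q * (Real.sqrt α / 2 * Real.sqrt α / 2 -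
          (4 * Real.log 2 - 2) * (Real.sqrt α / 2) ^ 2 / 2) =
          (Q * Real.sqrt α ^ 2) * ((1 - Real.log 2) / 2) := by ring
      rw [h2, hsq, hQα]
      nlinarith
    · rw [hsq]
      linarith
  · have hx : maxSqrt α = α := by
      rw [maxSqrt, max_eq_left]
      exact Real.sqrt_le_left (by linarith) |>.2 (by nlinarith)
    refine ⟨1 / 2, by norm_num, le_rfl, ?_⟩
    rw [hx]
    have hlow : Q * α / 4 ≤ Q * (α ^ 2 / 4) := by nlinarith [mul_pos hQ hα0]
    have hup : Q * (1 / 2 * α / 2 - (4 * Real.log 2 - 2) * (1 / 2) ^ 2 / 2) =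
        Q * α / 4 - Q * ((2 * Real.log 2 - 1) / 4) := by ring
    have hQα' : Q ≤ Q * α := by nlinarith
    rw [hup]
    have hc : Q * ((2 * Real.log 2 - 1) / 4) ≤ Q * 0.0966 := by
      refine mul_le_mul_of_nonneg_left ?_ hQ.le
      linarith
    rcases le_or_gt 8 d with h8 | h8
    · have hℓ3 := hlog 3 (by simpa using h8)
      push_cast at hℓ3
      refine exp_tails_le_of_exponents (a₀ := 0.23) (b₀ := 3) (by norm_num) (by norm_num) ?_ ?_
        (by norm_num)
      · linarith
      · linarith
    · have hbd : 0.0966 * (d : ℝ) + 0.7 ≤ 42 / 29 * ℓ ∧ 1 ≤ 42 / 29 * ℓ := by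
        rcases le_or_gt 4 d with h4 | h4
        · have hℓ2 := hlog 2 (by simpa using h4)
          push_cast at hℓ2
          have : (d : ℝ) ≤ 7 := by exact_mod_cast (by omega : d ≤ 7)
          constructor <;> linarith
        · have : (d : ℝ) ≤ 3 := by exact_mod_cast (by omega : d ≤ 3)
          constructor <;> linarith
      refine exp_tails_le_of_exponents (a₀ := 0.7) (b₀ := 1) (by norm_num) (by norm_num) ?_ ?_
        (by norm_num)
      · linarith
      · linarith

variable {Ω : Type*} [MeasurableSpace Ω] {P : Measure Ω} [IsProbabilityMeasure P]
  {ι : Type*} [Fintype ι]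

/-- Concentration of the averaged squared norm of independent Gaussian vectors. -/
theorem measure_norm_sq_deviation_le {N : ℕ} (hN : 0 < N) {X : Fin N → Ω → EuclideanSpace ℝ ι}
    (hXm : ∀ i, AEMeasurable (X i) P) (hind : iIndepFun X P)
    (b : OrthonormalBasis ι ℝ (EuclideanSpace ℝ ι)) {lam : ι → ℝ} (hlam : ∀ j, 0 ≤ lam j)
    (hX : ∀ i T, P.map (fun ω => (inner ℝ (X i ω) T : ℝ)) =
      gaussianReal 0 (Real.toNNReal (∑ j, lam j * inner ℝ (b j) T ^ 2)))
    {L D : ℝ} (hL : 0 < L) (hlamL : ∀ j, lam j ≤ L) (hV : ∑ j, lam j ^ 2 ≤ D * L)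
    {x y : ℝ} (hx : 0 ≤ x) (hy0 : 0 ≤ y) (hy : y ≤ 1 / 2) :
    P.real {ω | D * x < |(1 / (N : ℝ)) * ∑ i, ‖X i ω‖ ^ 2 - ∑ j, lam j|} ≤
      Real.exp (-(N * D / L * (y * x / 2 - (4 * Real.log 2 - 2) * y ^ 2 / 2))) +
        Real.exp (-(N * D / L * (x ^ 2 / 4))) := by
  have hN' : (0 : ℝ) < N := by exact_mod_cast hN
  set T := ∑ j, lam j
  have hylam : ∀ z : ℝ, 0 ≤ z → ∀ j, 0 ≤ z * lam j / L ∧ z * lam j / L ≤ z := by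
    intro z hz j
    refine ⟨by have := hlam j; positivity, ?_⟩
    rw [div_le_iff₀ hL]
    exact mul_le_mul_of_nonneg_left (hlamL j) hz
  have hsub : {ω | D * x < |(1 / (N : ℝ)) * ∑ i, ‖X i ω‖ ^ 2 - T|} ⊆
      {ω | N * T + N * (D * x) ≤ ∑ i, ‖X i ω‖ ^ 2} ∪
        {ω | ∑ i, ‖X i ω‖ ^ 2 ≤ N * T - N * (D * x)} := by
    intro ω hω
    rw [Set.mem_ofPred_eq, one_div_mul_eq_div, lt_abs] at hω
    rcases hω with h | h
    · left
      have : T + D * x < (∑ i, ‖X i ω‖ ^ 2) / N := by linarith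
      rw [lt_div_iff₀ hN'] at this
      simp only [Set.mem_ofPred_eq]
      linarith
    · right
      have : (∑ i, ‖X i ω‖ ^ 2) / N < T - D * x := by linarith
      rw [div_lt_iff₀ hN'] at this
      simp only [Set.mem_ofPred_eq]
      linarith
  refine (measureReal_mono hsub).trans ((measureReal_union_le _ _).trans (add_le_add ?_ ?_))
  · have hK : 0 ≤ 4 * Real.log 2 - 2 := by linarith [Real.log_two_gt_d9]
    have hsl : ∀ j, 2 * (y / (2 * L)) * lam j = y * lam j / L := fun j => by field_simp
    obtain ⟨hi, hm⟩ := integrable_and_mgf_sum_norm_sq_le hXm hind b hlam hX (s := y / (2 * L))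
      (K := 4 * Real.log 2 - 2)
      (fun j => by rw [hsl]; linarith [(hylam y hy0 j).2])
      (fun j => by
        rw [hsl]
        exact neg_log_one_sub_le (hylam y hy0 j).1 ((hylam y hy0 j).2.trans hy))
    refine (measure_ge_le_exp_mul_mgf _ (by positivity) hi).trans ?_
    refine (mul_le_mul_of_nonneg_left hm (Real.exp_pos _).le).trans ?_
    rw [← Real.exp_add]
    refine Real.exp_le_exp.2 ?_
    have h1 : 2 * (4 * Real.log 2 - 2) * (y / (2 * L)) ^ 2 * ∑ j, lam j ^ 2 ≤
        2 * (4 * Real.log 2 - 2) * (y / (2 * L)) ^ 2 * (D * L) :=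
      mul_le_mul_of_nonneg_left hV (by positivity)
    have h2 : 2 * (4 * Real.log 2 - 2) * (y / (2 * L)) ^ 2 * (D * L) =
        D / L * ((4 * Real.log 2 - 2) * y ^ 2 / 2) := by
      field_simp
    rw [h2] at h1
    have h3 := mul_le_mul_of_nonneg_left h1 hN'.le
    have h4 : y / (2 * L) * (N * (D * x)) = N * D / L * (y * x / 2) := by
      field_simp
    have h5 : (N : ℝ) * (D / L * ((4 * Real.log 2 - 2) * y ^ 2 / 2)) =
        N * D / L * ((4 * Real.log 2 - 2) * y ^ 2 / 2) := by ring
    rw [h5] at h3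
    linarith
  -- For the lower tail s = -x/(2L) is the optimal parameter, maximizing zx/2 - z²/4 at z = x.
  · have hsl : ∀ j, 2 * (-x / (2 * L)) * lam j = -(x * lam j / L) := fun j => by field_simp
    obtain ⟨hi, hm⟩ := integrable_and_mgf_sum_norm_sq_le hXm hind b hlam hX (s := -x / (2 * L))
      (K := 1 / 2)
      (fun j => by rw [hsl]; linarith [(hylam x hx j).1])
      (fun j => by
        rw [hsl]
        exact neg_log_one_add_le (by linarith [(hylam x hx j).1]))
    have hs0 : -x / (2 * L) ≤ 0 := div_nonpos_of_nonpos_of_nonneg (by linarith) (by positivity)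
    refine (measure_le_le_exp_mul_mgf _ hs0 hi).trans ?_
    refine (mul_le_mul_of_nonneg_left hm (Real.exp_pos _).le).trans ?_
    rw [← Real.exp_add]
    refine Real.exp_le_exp.2 ?_
    have h1 : 2 * (1 / 2) * (-x / (2 * L)) ^ 2 * ∑ j, lam j ^ 2 ≤
        2 * (1 / 2) * (-x / (2 * L)) ^ 2 * (D * L) :=
      mul_le_mul_of_nonneg_left hV (by positivity)
    have h2 : 2 * (1 / 2) * (-x / (2 * L)) ^ 2 * (D * L) = D / L * (x ^ 2 / 4) := by
      field_simp
      ring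
    rw [h2] at h1
    have h3 := mul_le_mul_of_nonneg_left h1 hN'.le
    have h4 : -x / (2 * L) * (N * (D * x)) = -(N * D / L * (x ^ 2 / 2)) := by
      field_simp
    have h5 : (N : ℝ) * (D / L * (x ^ 2 / 4)) = N * D / L * (x ^ 2 / 4) := by ring
    rw [h5] at h3
    linarith

end Tail

/-! ### The covariance operator and the trace of the sample covariance -/

section Covariance

variable {r : ℕ} {n m : Fin r → ℕ} (A : (k : Fin r) → Matrix (Fin (n k)) (Fin (m k)) ℝ)

theorem tucker_mul_transpose_posSemidef : (tucker A * (tucker A)ᵀ).PosSemidef := by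
  simpa using Matrix.posSemidef_self_mul_conjTranspose (tucker A)

theorem card_Idx (n : Fin r → ℕ) : (Fintype.card (Idx n) : ℝ) = ∏ k, (n k : ℝ) := by
  simp [Idx]

theorem rank_tucker_mul_transpose_le : (tucker A * (tucker A)ᵀ).rank ≤ ∏ k, m k := by
  refine (Matrix.rank_mul_le_left _ _).trans ((Matrix.rank_le_card_width _).trans_eq ?_)
  simp [Idx]

/-- The eigenvalues of `Σ` in the eigenbasis of `F_A F_A^*`. -/
noncomputable def covEigenvalue (σ : ℝ) (j : Idx n) : ℝ :=
  σ ^ 2 + (tucker_mul_transpose_posSemidef A).1.eigenvalues j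

/-- An orthonormal eigenbasis of `Σ`. -/
noncomputable def covBasis : OrthonormalBasis (Idx n) ℝ (Tensor n) :=
  (tucker_mul_transpose_posSemidef A).1.eigenvectorBasis

theorem sq_le_covEigenvalue (σ : ℝ) (j : Idx n) : σ ^ 2 ≤ covEigenvalue A σ j :=
  le_add_of_nonneg_right ((tucker_mul_transpose_posSemidef A).eigenvalues_nonneg j)

theorem covEigenvalue_nonneg (σ : ℝ) (j : Idx n) : 0 ≤ covEigenvalue A σ j :=
  (sq_nonneg σ).trans (sq_le_covEigenvalue A σ j)

theorem sum_covEigenvalue (σ : ℝ) : ∑ j, covEigenvalue A σ j = (cov A σ).trace := by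
  rw [cov, Matrix.trace_add, (tucker_mul_transpose_posSemidef A).1.trace_eq_sum_eigenvalues]
  simp [covEigenvalue, Finset.sum_add_distrib, mul_comm]

theorem trace_cov (σ : ℝ) :
    (cov A σ).trace = (∏ k, (n k : ℝ)) * σ ^ 2 + (tucker (gram A)).trace := by
  rw [cov, Matrix.trace_add, tucker_mul_transpose, Matrix.trace_smul, Matrix.trace_one, card_Idx,
    smul_eq_mul, mul_comm]

theorem toEuclideanLin_cov_covBasis (σ : ℝ) (j : Idx n) :
    Matrix.toEuclideanLin (cov A σ) (covBasis A j) = covEigenvalue A σ j • covBasis A j := by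
  have h := (tucker_mul_transpose_posSemidef A).1.mulVec_eigenvectorBasis j
  ext i
  have hi := congrFun h i
  simp only [Matrix.toLpLin_apply, cov, Matrix.add_mulVec, Matrix.smul_mulVec, Matrix.one_mulVec,
    covBasis, covEigenvalue, PiLp.smul_apply, Pi.add_apply, Pi.smul_apply, smul_eq_mul] at hi ⊢
  rw [hi]
  ring

theorem inner_cov_self (σ : ℝ) (T : Tensor n) :
    inner ℝ (Matrix.toEuclideanLin (cov A σ) T) T =
      ∑ j, covEigenvalue A σ j * inner ℝ (covBasis A j) T ^ 2 := by
  conv_lhs => rw [← (covBasis A).sum_repr' T, map_sum, sum_inner]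
  simp only [map_smul, toEuclideanLin_cov_covBasis, inner_smul_left, (covBasis A).sum_repr']
  refine Finset.sum_congr rfl fun j _ => ?_
  simp
  ring

theorem covEigenvalue_le_opNorm (σ : ℝ) (j : Idx n) :
    covEigenvalue A σ j ≤ opNorm (cov A σ) := by
  have h := (LinearMap.toContinuousLinearMap (Matrix.toEuclideanLin (cov A σ))).le_opNorm
    (covBasis A j)
  rw [LinearMap.coe_toContinuousLinearMap', toEuclideanLin_cov_covBasis, norm_smul,
    (covBasis A).norm_eq_one, mul_one, mul_one, Real.norm_eq_abs] at h
  exact (le_abs_self _).trans h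

/-- An empty mode would make A_kA_kᵀ vanish, and the signal with it. -/
theorem one_le_of_signal_pos (hsignal : 0 < signal A) (k : Fin r) : 1 ≤ m k := by
  by_contra h
  have h0 : m k = 0 := by omega
  have : IsEmpty (Fin (m k)) := by rw [h0]; infer_instance
  have h1 := frob_gram_pos A hsignal k
  rw [frob_eq_sqrt] at h1
  simp [gram, Matrix.mul_apply] at h1

/-- Valid also for σ = 0: F_B is nonzero because its contraction with the B_k is ∏‖B_k‖_F² > 0. -/
theorem opNorm_cov_pos (hsignal : 0 < signal A) (σ : ℝ) : 0 < opNorm (cov A σ) := by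
  have h0 : tucker A * (tucker A)ᵀ ≠ 0 := by
    rw [tucker_mul_transpose]
    intro h
    have h1 := signalHat_tucker (gram A) (gram A)
    have h2 : 0 < ∏ k, (inner ℝ (vec (gram A k)) (vec (gram A k)) : ℝ) :=
      Finset.prod_pos fun k _ => by
        rw [real_inner_self_eq_norm_sq]
        exact pow_pos (frob_gram_pos A hsignal k) 2
    rw [← h1, h] at h2
    simp [signalHat, pair] at h2
  by_contra hL
  refine h0 ((tucker_mul_transpose_posSemidef A).1.eigenvalues_eq_zero_iff.1 ?_)
  ext j
  have h1 := covEigenvalue_le_opNorm A σ j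
  have h2 := (tucker_mul_transpose_posSemidef A).eigenvalues_nonneg j
  rw [covEigenvalue] at h1
  rw [Pi.zero_apply]
  nlinarith [sq_nonneg σ]

/-- All but at most m eigenvalues of Σ equal σ², and the others are at most ‖Σ‖. The quantity D is
designed for this bound. -/
theorem sum_covEigenvalue_sq_le (hmn : ∀ k, m k ≤ n k) (hsignal : 0 < signal A) (σ : ℝ) :
    ∑ j, covEigenvalue A σ j ^ 2 ≤ effDim A σ * opNorm (cov A σ) := by
  classical
  have hL := opNorm_cov_pos A hsignal σ
  set L := opNorm (cov A σ) with hLdef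
  set hK := (tucker_mul_transpose_posSemidef A).1
  have hne : Nonempty (Idx n) :=
    ⟨fun k => ⟨0, (one_le_of_signal_pos A hsignal k).trans (hmn k)⟩⟩
  have hσL : σ ^ 2 ≤ L :=
    (sq_le_covEigenvalue A σ hne.some).trans (covEigenvalue_le_opNorm A σ _)
  have hσL2 : σ ^ 4 ≤ L ^ 2 := by nlinarith [sq_nonneg σ]
  have hD : effDim A σ * L =
      (∏ k, (m k : ℝ)) * L ^ 2 + ((∏ k, (n k : ℝ)) - ∏ k, (m k : ℝ)) * σ ^ 4 := by
    rw [effDim, ← hLdef, add_mul, div_mul_cancel₀ _ hL.ne']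
    ring
  rw [hD]
  have h1 : ∀ j, covEigenvalue A σ j ^ 2 ≤
      σ ^ 4 + if hK.eigenvalues j ≠ 0 then L ^ 2 - σ ^ 4 else 0 := by
    intro j
    split_ifs with h
    · have := pow_le_pow_left₀ (covEigenvalue_nonneg A σ j) (covEigenvalue_le_opNorm A σ j) 2
      linarith
    · have h0 : hK.eigenvalues j = 0 := not_not.1 h
      have : covEigenvalue A σ j = σ ^ 2 := by
        rw [covEigenvalue]
        exact add_eq_left.2 h0
      rw [this]
      refine le_of_eq (by ring)
  refine (Finset.sum_le_sum fun j _ => h1 j).trans ?_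
  rw [Finset.sum_add_distrib, Finset.sum_const, Finset.card_univ, nsmul_eq_mul, card_Idx,
    ← Finset.sum_filter, Finset.sum_const, nsmul_eq_mul]
  have h2 := card_eigenvalues_ne_zero_le hK (rank_tucker_mul_transpose_le A)
  have h3 : ((Finset.univ.filter fun j => hK.eigenvalues j ≠ 0).card : ℝ) ≤ ∏ k, (m k : ℝ) := by
    exact_mod_cast h2
  nlinarith [mul_le_mul_of_nonneg_right h3 (sub_nonneg.2 hσL2)]

theorem effDim_bounds (hmn : ∀ k, m k ≤ n k) (hsignal : 0 < signal A) (σ : ℝ) :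
    0 < effDim A σ ∧ effDim A σ ≤ (∏ k, (n k : ℝ)) * opNorm (cov A σ) := by
  have hL := opNorm_cov_pos A hsignal σ
  have hm : 0 < ∏ k, (m k : ℝ) :=
    Finset.prod_pos fun k _ => by exact_mod_cast one_le_of_signal_pos A hsignal k
  have hle : ∏ k, (m k : ℝ) ≤ ∏ k, (n k : ℝ) :=
    Finset.prod_le_prod (fun _ _ => Nat.cast_nonneg _) fun k _ => by exact_mod_cast hmn k
  have hne : Nonempty (Idx n) :=
    ⟨fun k => ⟨0, (one_le_of_signal_pos A hsignal k).trans (hmn k)⟩⟩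
  have hσL : σ ^ 2 ≤ opNorm (cov A σ) :=
    (sq_le_covEigenvalue A σ hne.some).trans (covEigenvalue_le_opNorm A σ _)
  set L := opNorm (cov A σ) with hLdef
  have hσL2 : σ ^ 4 / L ≤ L := by
    rw [div_le_iff₀ hL]
    nlinarith [sq_nonneg σ]
  have h0 : 0 ≤ σ ^ 4 / L := by positivity
  rw [effDim, ← hLdef, mul_div_assoc]
  have h1 := mul_nonneg (sub_nonneg.2 hle) h0
  have h2 := mul_le_mul_of_nonneg_left hσL2 (sub_nonneg.2 hle)
  constructor
  · nlinarith
  · nlinarith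

variable {Ω : Type*} [MeasurableSpace Ω] {P : Measure Ω}

/-- Linear functionals of the model are Gaussian with covariance `Σ`. -/
theorem IsTPCA.aemeasurable_and_map_inner {X : Ω → Tensor n} {σ : ℝ} (h : IsTPCA P X 0 A σ) :
    AEMeasurable X P ∧ ∀ T, P.map (fun ω => (inner ℝ (X ω) T : ℝ)) =
      gaussianReal 0 (Real.toNNReal (∑ j, covEigenvalue A σ j * inner ℝ (covBasis A j) T ^ 2)) := by
  obtain ⟨-, Z, ε, ⟨hZm, hZ⟩, ⟨hεm, hε⟩, hind, hX⟩ := h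
  have hcont : Continuous (Matrix.toEuclideanLin (tucker A)) :=
    LinearMap.continuous_of_finiteDimensional _
  constructor
  · refine AEMeasurable.congr (f := fun ω => 0 + Matrix.toEuclideanLin (tucker A) (Z ω) + ε ω) ?_
      (hX.mono fun ω hω => hω.symm)
    exact (aemeasurable_const.add (hcont.measurable.comp_aemeasurable hZm)).add hεm
  · intro T
    set T' := Matrix.toEuclideanLin (tucker A)ᵀ T
    have hadj : ∀ z, inner ℝ (Matrix.toEuclideanLin (tucker A) z) T = (inner ℝ z T' : ℝ) := by
      intro z
      simp only [T', PiLp.inner_apply, Matrix.toLpLin_apply, RCLike.inner_apply, conj_trivial]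
      have h1 := Matrix.dotProduct_mulVec T.ofLp (tucker A) z.ofLp
      rw [← Matrix.mulVec_transpose] at h1
      simpa [dotProduct, mul_comm] using h1
    have h1 : P.map (fun ω => (inner ℝ (X ω) T : ℝ)) =
        P.map ((fun ω => (inner ℝ (Z ω) T' : ℝ)) + fun ω => (inner ℝ (ε ω) T : ℝ)) := by
      refine Measure.map_congr (hX.mono fun ω hω => ?_)
      simp only [Pi.add_apply]
      rw [hω, zero_add, inner_add_left, hadj]
    have hind' : IndepFun (fun ω => (inner ℝ (Z ω) T' : ℝ)) (fun ω => (inner ℝ (ε ω) T : ℝ)) P :=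
      hind.comp (φ := fun z => (inner ℝ z T' : ℝ)) (ψ := fun z => (inner ℝ z T : ℝ))
        (by fun_prop) (by fun_prop)
    have hone : ∀ (q : Fin r → ℕ) (z : Tensor q), Matrix.toEuclideanLin (1 : Op q q) z = z := by
      intro q z
      simp
    have hsm : Matrix.toEuclideanLin (σ ^ 2 • (1 : Op n n)) T = σ ^ 2 • T := by
      rw [map_smul, LinearMap.smul_apply, hone]
    rw [h1, gaussianReal_add_gaussianReal_of_indepFun hind' (hZ T') (hε T), inner_zero_left,
      inner_zero_left, add_zero, hone, hsm, ← Real.toNNReal_add real_inner_self_nonneg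
        (by rw [inner_smul_left]; exact mul_nonneg (sq_nonneg σ) real_inner_self_nonneg),
      ← inner_cov_self]
    congr 2
    rw [← hadj]
    have : Matrix.toEuclideanLin (cov A σ) T =
        Matrix.toEuclideanLin (tucker A) T' + σ ^ 2 • T := by
      rw [cov, map_add, LinearMap.add_apply, hsm, add_comm]
      congr 1
      simp [T', Matrix.toLpLin_apply, Matrix.mulVec_mulVec]
    rw [this, inner_add_left]

theorem trace_sampleCov {N : ℕ} (x : Fin N → Tensor n) :
    (sampleCov x).trace = (1 / (N : ℝ)) * ∑ i, ‖x i‖ ^ 2 := by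
  simp only [Matrix.trace, Matrix.diag, sampleCov, Matrix.of_apply, EuclideanSpace.norm_sq_eq]
  rw [← Finset.mul_sum, Finset.sum_comm]
  simp [sq]

/-- The trace of the sample covariance deviates from that of `Σ` by more than `n t₄` with
probability at most `N⁻² n⁻²`. -/
theorem measure_trace_deviation_le [IsProbabilityMeasure P] (hmn : ∀ k, m k ≤ n k) {σ : ℝ} {N : ℕ}
    (hN : 0 < N) {X : Fin N → Ω → Tensor n} (hX : ∀ i, IsTPCA P (X i) 0 A σ) (hind : iIndepFun X P)
    (hsignal : 0 < signal A) :
    P.real {ω | effDim A σ * maxSqrt (alpha₄ A σ N) <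
        |(sampleCov fun i => X i ω).trace - (cov A σ).trace|} ≤
      1 / ((N : ℝ) ^ 2 * (∏ k, (n k : ℝ)) ^ 2) := by
  have hL := opNorm_cov_pos A hsignal σ
  obtain ⟨hD, hDn⟩ := effDim_bounds A hmn hsignal σ
  have hnpos : ∀ k, 1 ≤ n k := fun k => (one_le_of_signal_pos A hsignal k).trans (hmn k)
  have hn : 0 < ∏ k, (n k : ℝ) := Finset.prod_pos fun k _ => by exact_mod_cast hnpos k
  have hN' : (0 : ℝ) < N := by exact_mod_cast hN
  set d : ℕ := N * ∏ k, n k with hd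
  have hdcast : (d : ℝ) = N * ∏ k, (n k : ℝ) := by simp [hd]
  have hd0 : 0 < d := Nat.mul_pos hN (Finset.prod_pos fun k _ => hnpos k)
  have hd0' : (0 : ℝ) < d := by exact_mod_cast hd0
  rw [← mul_pow, ← hdcast]
  -- For Nn = 1 the claimed bound is 1, hence trivial; otherwise log(Nn) > 0.
  rcases (Nat.succ_le_of_lt hd0).eq_or_lt with h1 | h1
  · rw [← h1]
    simp
  set L := opNorm (cov A σ) with hLdef
  set D := effDim A σ
  have hα : 0.145 * (N * D / L * alpha₄ A σ N) = 2 * Real.log d := by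
    rw [alpha₄, ← hLdef, ← hdcast]
    have : effDim A σ = D := rfl
    rw [this]
    field_simp
  have hQd : N * D / L ≤ d := by
    rw [div_le_iff₀ hL, hdcast, mul_assoc]
    exact mul_le_mul_of_nonneg_left hDn hN'.le
  obtain ⟨y, hy0, hy, hexp⟩ := exists_exp_tails_le h1 (by positivity) hQd hα
  have hx : 0 ≤ maxSqrt (alpha₄ A σ N) := (Real.sqrt_nonneg _).trans (le_max_right _ _)
  have h2 := measure_norm_sq_deviation_le hN (fun i => ((hX i).aemeasurable_and_map_inner A).1)
    hind (covBasis A) (covEigenvalue_nonneg A σ)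
    (fun i => ((hX i).aemeasurable_and_map_inner A).2) hL (covEigenvalue_le_opNorm A σ)
    (sum_covEigenvalue_sq_le A hmn hsignal σ) hx hy0 hy
  simp only [trace_sampleCov, ← sum_covEigenvalue]
  refine h2.trans (hexp.trans_eq ?_)
  rw [Real.exp_neg, mul_comm, Real.exp_mul, Real.exp_log hd0', one_div]
  norm_num

end Covariance

/-! ### Combination of the two errors. -/

theorem psi_nonneg {r : ℕ} {n m : Fin r → ℕ} (A : (k : Fin r) → Matrix (Fin (n k)) (Fin (m k)) ℝ)
    {σ : ℝ} (hσ : 0 ≤ σ) (N : ℕ) (δ₁ δ₂ δ₃ : ℝ) : 0 ≤ psi A σ N δ₁ δ₂ δ₃ := by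
  have hx : ∀ x, 0 ≤ maxSqrt x := fun x => (Real.sqrt_nonneg _).trans (le_max_right _ _)
  have hA : 0 ≤ loadNorm A := Finset.prod_nonneg fun _ _ => norm_nonneg _
  have h1 := hx (alpha₁ n N δ₁)
  have h2 := hx (alpha₂ m N δ₂)
  have h3 := hx (alpha₃ n m N δ₃)
  rw [psi]
  positivity

end TPCA

theorem mainTheorem5 {Ω : Type*} [MeasurableSpace Ω] (P : Measure Ω) [IsProbabilityMeasure P]
    {r : ℕ} (hr : 2 ≤ r) (n m : Fin r → ℕ) (hmn : ∀ k, m k ≤ n k)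
    (A : (k : Fin r) → Matrix (Fin (n k)) (Fin (m k)) ℝ) (σ : ℝ) (hσ : 0 ≤ σ)
    -- the sample: independent copies from the model with mean zero
    (N : ℕ) (hN : 0 < N) (X : Fin N → Ω → TPCA.Tensor n)
    (hX : ∀ i, TPCA.IsTPCA P (X i) 0 A σ) (hindep : iIndepFun X P)
    -- equal scaling, with non-degenerate signal
    (hscale : ∀ k l, TPCA.frob (TPCA.gram A k) = TPCA.frob (TPCA.gram A l))
    (hsignal : 0 < TPCA.signal A)
    -- the noise level `ψ`
    (δ₁ δ₂ δ₃ : ℝ) (hδ₁ : δ₁ ∈ Set.Ioo (0 : ℝ) 1) (hδ₂ : δ₂ ∈ Set.Ioo (0 : ℝ) 1)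
    (hδ₃ : δ₃ ∈ Set.Ioo (0 : ℝ) 1)
    (ψ : ℝ) (hψ : ψ = TPCA.psi A σ N δ₁ δ₂ δ₃)
    -- the signal-to-noise condition and the range of `τ`
    (hsnr : (ψ / TPCA.signal A) ^ 2 <
      1 / (32 * ∏ k, (m k : ℝ)) * (1 / (r : ℝ)) * (1 - 1 / (r : ℝ)) ^ (r - 1))
    (τ : ℝ) (hτ : 0 < τ) (hτ₁ : τ < TPCA.tauOne r (∏ k, (m k : ℝ)) (ψ / TPCA.signal A)) :
    ∃ G : Set Ω, MeasurableSet G ∧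
      1 - ENNReal.ofReal (1 / ((N : ℝ) ^ 2 * (∏ k, (n k : ℝ)) ^ 2)) ≤ P G ∧
      ∀ ω ∈ G,
        -- the event `E(ψ)`
        TPCA.mlNorm (TPCA.noise A σ fun i => X i ω) ≤ ψ →
        -- every admissible initialization, and every outcome of one iteration started from it
        ∀ B₀ B₁ : (k : Fin r) → Matrix (Fin (n k)) (Fin (n k)) ℝ,
          TPCA.IsFeasible m B₀ →
          (∀ k, Real.sin (TPCA.initAngle A k (B₀ k)) ≤ τ) →
          TPCA.IsIteration m (TPCA.sampleCov fun i => X i ω) B₀ B₁ →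
          |TPCA.sigmaSqHat (TPCA.sampleCov fun i => X i ω) B₁ - σ ^ 2| ≤
            Real.sqrt (∏ k, (m k : ℝ)) * TPCA.signal A / (∏ k, (n k : ℝ)) *
              ((1 + 2 * TPCA.f₁ r (∏ k, (m k : ℝ)) (ψ / TPCA.signal A) τ
                + Real.sqrt 2 * TPCA.f₂ r (∏ k, (m k : ℝ)) (ψ / TPCA.signal A) τ) ^ r - 1)
              + TPCA.t₄ A σ N := by
  have hψ0 : 0 ≤ ψ := hψ ▸ TPCA.psi_nonneg A hσ N δ₁ δ₂ δ₃
  have hn : 0 < ∏ k, (n k : ℝ) := Finset.prod_pos fun k _ => by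
    exact_mod_cast (TPCA.one_le_of_signal_pos A hsignal k).trans (hmn k)
  set bad : Set Ω := {ω | TPCA.effDim A σ * TPCA.maxSqrt (TPCA.alpha₄ A σ N) <
    |(TPCA.sampleCov fun i => X i ω).trace - (TPCA.cov A σ).trace|}
  have hP := TPCA.measure_trace_deviation_le A hmn hN hX hindep hsignal
  -- The X_i are only almost everywhere measurable, so the deviation set is replaced by a measurable
  -- hull of the same measure.
  refine ⟨(toMeasurable P bad)ᶜ, (measurableSet_toMeasurable P bad).compl, ?_, ?_⟩
  · rw [prob_compl_eq_one_sub (measurableSet_toMeasurable P bad), measure_toMeasurable]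
    refine tsub_le_tsub_left ?_ 1
    rw [← ofReal_measureReal]
    exact ENNReal.ofReal_le_ofReal hP
  · intro ω hω hnoise B₀ B₁ hB hsin hit
    have htr : |(TPCA.sampleCov fun i => X i ω).trace - (TPCA.cov A σ).trace| ≤
        TPCA.effDim A σ * TPCA.maxSqrt (TPCA.alpha₄ A σ N) := by
      by_contra h
      exact hω (subset_toMeasurable P bad (not_le.1 h))
    have hS : (TPCA.sampleCov fun i => X i ω) =
        TPCA.tucker (TPCA.gram A) + TPCA.noise A σ fun i => X i ω := by
      rw [TPCA.noise, TPCA.cov, TPCA.tucker_mul_transpose]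
      abel
    have hdet := TPCA.abs_trace_tucker_gramHat_sub_le A hr hscale hsignal hnoise hψ0 hτ hτ₁ hB hsin
      (hS ▸ hit)
    rw [← hS] at hdet
    rw [TPCA.trace_cov] at htr
    set S := TPCA.sampleCov fun i => X i ω
    set p := ∏ k, (n k : ℝ) with hp
    have hsplit : TPCA.sigmaSqHat S B₁ - σ ^ 2 =
        ((S.trace - (p * σ ^ 2 + (TPCA.tucker (TPCA.gram A)).trace)) -
          ((TPCA.tucker (TPCA.gramHat S B₁)).trace - (TPCA.tucker (TPCA.gram A)).trace)) / p := by
      rw [TPCA.sigmaSqHat, ← hp, Matrix.trace_sub]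
      field_simp
      ring
    rw [hsplit, abs_div, abs_of_pos hn, div_le_iff₀ hn]
    refine (abs_sub _ _).trans ?_
    refine (add_le_add htr hdet).trans_eq ?_
    rw [TPCA.t₄, ← hp]
    field_simp
    ring
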